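/- Let $k$ be a real closed field with its ordering $\leqslant$, and let $\overline{k}$ be an algebraic closure of $k$. Consider the first-order language with constant symbols $0,1$, binary function symbols $+,\cdot$, a unary function symbol $*$ and a binary relation symbol $\leqslant$. Regard $\overline{k}$ as a structure in this language, where $0,1,+,\cdot$ are interpreted as in the field $\overline{k}$, where $*$ is interpreted as complex conjugation, i.e. $(a+bi)^*=a-bi$ for $a,b\in k$ and $i\in\overline{k}$ with $i^2=-1$, and where $x\leqslant y$ holds if and only if $x,y\in k$ and $x\leqslant y$ in the ordering of $k$. Then $\overline{k}$ admits quantifier elimination: for every $m\geq 0$ and every formula $\varphi(x_1,\dots,x_m)$ of this language (without parameters) there is a quantifier-free formula $\psi(x_1,\dots,x_m)$ of this language such that $\varphi$ and $\psi$ define the same subset of $\overline{k}^{\,m}$. -/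

import Mathlib

open FirstOrder

/-- An `L`-structure `M` admits quantifier elimination: for every formula `φ(x₁, …, xₘ)` without
parameters there is a quantifier-free formula `ψ(x₁, …, xₘ)` defining the same subset of `Mᵐ`. -/
def AdmitsQuantifierElimination (L : Language) (M : Type*) [L.Structure M] : Prop :=
  ∀ (m : ℕ) (φ : L.Formula (Fin m)), ∃ ψ : L.Formula (Fin m),
    ψ.IsQF ∧ {v : Fin m → M | φ.Realize v} = {v : Fin m → M | ψ.Realize v}

/-- Function symbols of the language `(+, ·, 0, 1, *, ≤)`. -/
inductive StarOrderedRingFunc : ℕ → Type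
  | add : StarOrderedRingFunc 2
  | mul : StarOrderedRingFunc 2
  | zero : StarOrderedRingFunc 0
  | one : StarOrderedRingFunc 0
  | star : StarOrderedRingFunc 1

/-- Relation symbols of the language `(+, ·, 0, 1, *, ≤)` (equality is a logical symbol). -/
inductive StarOrderedRingRel : ℕ → Type
  | le : StarOrderedRingRel 2

/-- The language `(+, ·, 0, 1, *, ≤)`: the language of rings with constants `0`, `1` and binary
operations `+`, `·`, extended by a unary function symbol `*` and a binary relation symbol `≤`. -/
def starOrderedRing : Language := ⟨StarOrderedRingFunc, StarOrderedRingRel⟩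

section ComplexConj

variable (k K : Type*) [Field k] [IsRealClosed k] [Field K] [Algebra k K] [IsAlgClosure k K]

theorem exists_complexConj : ∃ σ : K ≃ₐ[k] K, ∀ i : K, i ^ 2 = -1 → σ i = -i := by
  have : IsAlgClosed K := IsAlgClosure.isAlgClosed k
  have : Algebra.IsAlgebraic k K := IsAlgClosure.isAlgebraic
  have : Normal k K := IsAlgClosure.normal k K
  obtain ⟨j, hj⟩ := IsAlgClosed.exists_pow_nat_eq (-1 : K) (n := 2) (by norm_num)
  have hirr : Irreducible (Polynomial.X ^ 2 + 1 : Polynomial k) := by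
    have hdeg : (Polynomial.X ^ 2 + 1 : Polynomial k).natDegree = 2 := by compute_degree!
    refine (Polynomial.irreducible_iff_roots_eq_zero_of_degree_le_three (by omega) (by omega)).2 ?_
    refine Multiset.eq_zero_of_forall_notMem fun a ha => ?_
    have h1 : a ^ 2 + 1 = 0 := by simpa using (Polynomial.mem_roots'.1 ha).2
    refine IsSemireal.not_isSumSq_neg_one (R := k) ?_
    have h2 : (-1 : k) = a * a := by linear_combination -h1
    rw [h2]
    exact (IsSquare.mul_self a).isSumSq
  have hmonic : (Polynomial.X ^ 2 + 1 : Polynomial k).Monic := by monicity!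
  have h1 : Polynomial.X ^ 2 + 1 = minpoly k j :=
    minpoly.eq_of_irreducible_of_monic hirr (by simp [hj]) hmonic
  have h2 : Polynomial.X ^ 2 + 1 = minpoly k (-j) :=
    minpoly.eq_of_irreducible_of_monic hirr (by simp [hj]) hmonic
  have hc : IsConjRoot k (-j) j := by rw [IsConjRoot, ← h1, ← h2]
  obtain ⟨σ, hσ⟩ := isConjRoot_iff_exists_algEquiv.1 hc
  have hσ : σ j = -j := hσ
  refine ⟨σ, fun i hi => ?_⟩
  rcases sq_eq_sq_iff_eq_or_eq_neg.1 (hi.trans hj.symm) with rfl | rfl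
  · exact hσ
  · rw [map_neg, hσ]

/-- Complex conjugation on the algebraic closure `K` of a real closed field `k`: the automorphism
of `K` over `k` that sends the square roots of `-1` to their negatives. As every element of `K` is
`a + b i` with `a`, `b` in `k` and `i ^ 2 = -1`, it is determined by this property. -/
noncomputable def complexConj : K ≃ₐ[k] K := Classical.choose (exists_complexConj k K)

theorem complexConj_of_sq_eq_neg_one {i : K} (hi : i ^ 2 = -1) : complexConj k K i = -i :=
  Classical.choose_spec (exists_complexConj k K) i hi

theorem complexConj_add_mul (a b : k) {i : K} (hi : i ^ 2 = -1) :
    complexConj k K (algebraMap k K a + algebraMap k K b * i) =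
      algebraMap k K a - algebraMap k K b * i := by
  simp [complexConj_of_sq_eq_neg_one k K hi, sub_eq_add_neg]

end ComplexConj

/-- The algebraic closure `K` of the real closed field `k` as a structure in `(+, ·, 0, 1, *, ≤)`:
the field operations, complex conjugation, and the order of `k`, as a relation on `K` that holds
only between elements of `k`. -/
@[reducible]
noncomputable def algClosureStructure (k K : Type*) [Field k] [LinearOrder k] [IsRealClosed k]
    [Field K] [Algebra k K] [IsAlgClosure k K] : starOrderedRing.Structure K where
  funMap := fun {n} f =>
    match n, f with
    | _, .add => fun x => x 0 + x 1
    | _, .mul => fun x => x 0 * x 1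
    | _, .zero => fun _ => 0
    | _, .one => fun _ => 1
    | _, .star => fun x => complexConj k K (x 0)
  RelMap := fun {n} r =>
    match n, r with
    | _, .le => fun x => ∃ a b : k, algebraMap k K a = x 0 ∧ algebraMap k K b = x 1 ∧ a ≤ b

/-! An algebraic closure of `k` is `k(i)`, so a formula on `K` is a condition on real and imaginary
parts, and a quantifier over `K` is two quantifiers over `k`. By Tarski–Seidenberg
(`SignDetermined.exists_snd`) the defined set depends only on the signs of finitely many integer
polynomials in these coordinates (`Interprets.signDetermined_formula`).

It remains to return to the language, which cannot tell `i` from `-i`. Real parts `(x + x*) / 2` and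
products `im x * im y = -(x - x*)(y - y*) / 4` are expressible up to a power of `2`, but single
imaginary parts are not. They are not needed: conjugation is an automorphism, so the set is
invariant under it. If `im (v b) ≠ 0` and `t = 1 / |im (v b)|`, the point with coordinates `re (v a)
+ t * im (v a) * im (v b) * i` is `v` or its conjugate. Its coordinates are polynomial in `t` over
the expressible functions, and a further elimination removes `t`
(`Interprets.signDetermined_of_conj_invariant`).

Tarski–Seidenberg rests on `signControlled_of_degree_lt`: if the signs of suitable finitely many
coefficient expressions agree at two parameters, an order automorphism of the line carries the sign
pattern of the specialized polynomials at one parameter to that at the other, and hence witnesses to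
witnesses. A polynomial `p` of top degree is added to a family containing its derivative. At the
roots of the family its sign is that of a pseudo-remainder, which is under control by induction.
Between these roots `p` is monotone, so the intermediate value theorem decides where its roots lie,
and the automorphism is corrected there locally (`exists_signCompatible_extension`). -/

/-! ### The algebraic closure of a real closed field is `k(i)` -/

open Polynomial in
theorem IsRealClosed.finrank_eq_one_of_odd {k F : Type*} [Field k] [CharZero k] [IsRealClosed k]
    [Field F] [Algebra k F] [FiniteDimensional k F] (h : Odd (Module.finrank k F)) :
    Module.finrank k F = 1 := by
  obtain ⟨x, hx⟩ := Field.exists_primitive_element k F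
  have hint : IsIntegral k x := Algebra.IsIntegral.isIntegral x
  have hdeg := (Field.primitive_element_iff_minpoly_natDegree_eq k x).1 hx
  rw [← hdeg] at h ⊢
  obtain ⟨r, hr⟩ := IsRealClosed.exists_isRoot_of_odd_natDegree h
  exact natDegree_eq_of_degree_eq_some
    (degree_eq_one_of_irreducible_of_root (minpoly.irreducible hint) hr)

open Polynomial in
theorem finrank_ne_two_of_forall_isSquare {E F : Type*} [Field E] [CharZero E] [Field F]
    [Algebra E F] [FiniteDimensional E F] (h : ∀ x : E, IsSquare x) :
    Module.finrank E F ≠ 2 := by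
  intro h2
  obtain ⟨x, hx⟩ := Field.exists_primitive_element E F
  have hint : IsIntegral E x := Algebra.IsIntegral.isIntegral x
  have hdeg := (Field.primitive_element_iff_minpoly_natDegree_eq E x).1 hx
  rw [h2] at hdeg
  have hirr := minpoly.irreducible hint
  set p := minpoly E x
  have hp2 : p.coeff 2 ≠ 0 := by
    rw [← hdeg]; exact leadingCoeff_ne_zero.2 hirr.ne_zero
  obtain ⟨r, hr⟩ := exists_quadratic_eq_zero (a := p.coeff 2) (b := p.coeff 1) (c := p.coeff 0)
    hp2 (h _)
  have hroot : p.IsRoot r := by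
    rw [IsRoot, eval_eq_sum_range, hdeg]
    simp only [Finset.sum_range_succ, Finset.sum_range_zero]
    linear_combination hr
  have h1 : p.natDegree = 1 :=
    natDegree_eq_of_degree_eq_some (degree_eq_one_of_irreducible_of_root hirr hroot)
  omega

/-- With `n` the modulus of `a + bi`, the half-angle formulas give `s² = (n + a) / 2` and `t² = (n -
a) / 2`. Then `2st = ±b`, and the sign of `t` is chosen to fit. -/
theorem IsRealClosed.exists_sq_eq_add_mul {k L : Type*} [Field k] [LinearOrder k]
    [IsStrictOrderedRing k] [IsRealClosed k] [Field L] [Algebra k L] {i : L} (hi : i ^ 2 = -1)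
    (a b : k) : ∃ s t : k, (algebraMap k L s + algebraMap k L t * i) ^ 2 =
      algebraMap k L a + algebraMap k L b * i := by
  obtain ⟨n, hn⟩ := exists_eq_pow_of_nonneg (x := a ^ 2 + b ^ 2) (by positivity) two_ne_zero
  wlog hn0 : 0 ≤ n generalizing n
  · exact this (-n) (by rw [hn]; ring) (by linarith)
  have habs : |a| ≤ n := abs_le_of_sq_le_sq (by nlinarith [sq_nonneg b]) hn0
  obtain ⟨h1, h2⟩ := abs_le.1 habs
  obtain ⟨s, hs⟩ := exists_eq_pow_of_nonneg (x := (n + a) / 2) (by linarith) two_ne_zero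
  obtain ⟨t, ht⟩ := exists_eq_pow_of_nonneg (x := (n - a) / 2) (by linarith) two_ne_zero
  have hab : s ^ 2 - t ^ 2 = a := by rw [← hs, ← ht]; ring
  have key : (2 * s * t) ^ 2 = b ^ 2 := by
    have : (2 * s * t) ^ 2 = 4 * s ^ 2 * t ^ 2 := by ring
    rw [this, ← hs, ← ht]; linear_combination -hn
  have fin : ∀ t' : k, t' ^ 2 = t ^ 2 → 2 * s * t' = b →
      (algebraMap k L s + algebraMap k L t' * i) ^ 2 =
        algebraMap k L a + algebraMap k L b * i := by
    intro t' h1 h2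
    rw [← h2, ← hab, ← h1]
    simp only [map_sub, map_mul, map_pow, map_ofNat]
    linear_combination (algebraMap k L t') ^ 2 * hi
  rcases sq_eq_sq_iff_eq_or_eq_neg.1 key with h | h
  · exact ⟨s, t, fin t rfl h⟩
  · exact ⟨s, -t, fin (-t) (by ring) (by linear_combination -h)⟩

theorem exists_eq_add_mul_of_mem_adjoin {k L : Type*} [Field k] [Field L] [Algebra k L] {i : L}
    (hi : i ^ 2 = -1) {x : L} (hx : x ∈ IntermediateField.adjoin k {i}) :
    ∃ a b : k, x = algebraMap k L a + algebraMap k L b * i := by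
  have hint : IsIntegral k i := ⟨Polynomial.X ^ 2 + 1, by monicity!, by simp [hi]⟩
  rw [← IntermediateField.mem_toSubalgebra,
    IntermediateField.adjoin_simple_toSubalgebra_of_isAlgebraic hint.isAlgebraic] at hx
  induction hx using Algebra.adjoin_induction with
  | mem x hx => exact ⟨0, 1, by simpa using hx⟩
  | algebraMap r => exact ⟨r, 0, by simp⟩
  | add x y _ _ hx hy =>
    obtain ⟨a, b, rfl⟩ := hx
    obtain ⟨c, d, rfl⟩ := hy
    exact ⟨a + c, b + d, by simp only [map_add]; ring⟩
  | mul x y _ _ hx hy =>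
    obtain ⟨a, b, rfl⟩ := hx
    obtain ⟨c, d, rfl⟩ := hy
    refine ⟨a * c - b * d, a * d + b * c, ?_⟩
    simp only [map_add, map_sub, map_mul]
    linear_combination algebraMap k L b * algebraMap k L d * hi

/-- Artin's argument: the fixed field of a Sylow 2-subgroup has odd degree over `k`, hence degree 1,
so the Galois group is a 2-group. If `L` were larger than `k(i)`, an index 2 subgroup of its group
over `k(i)` would give a quadratic extension of `k(i)`, where every element is a square. -/
theorem IsRealClosed.adjoin_eq_top {k L : Type*} [Field k] [LinearOrder k]
    [IsStrictOrderedRing k] [IsRealClosed k] [Field L] [Algebra k L] [FiniteDimensional k L]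
    [IsGalois k L] {i : L} (hi : i ^ 2 = -1) : IntermediateField.adjoin k {i} = ⊤ := by
  have : Fact (Nat.Prime 2) := ⟨Nat.prime_two⟩
  have : CharZero L := charZero_of_injective_algebraMap (algebraMap k L).injective
  have hfin : Module.finrank k L = Nat.card (Gal(L/k)) := (IsGalois.card_aut_eq_finrank k L).symm
  obtain ⟨P⟩ : Nonempty (Sylow 2 (Gal(L/k))) := inferInstance
  let F := IntermediateField.fixedField (P : Subgroup (Gal(L/k)))
  have hFL : Module.finrank F L = Nat.card P := IntermediateField.finrank_fixedField_eq_card _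
  have hkF : Module.finrank k F = (P : Subgroup (Gal(L/k))).index := by
    have h1 := Module.finrank_mul_finrank k F L
    have h2 := (P : Subgroup (Gal(L/k))).card_mul_index
    rw [hFL, hfin, ← h2, mul_comm] at h1
    exact Nat.eq_of_mul_eq_mul_left Nat.card_pos h1
  have hodd : Odd (Module.finrank k F) := by
    rw [hkF, Nat.odd_iff, ← Nat.not_even_iff, even_iff_two_dvd]
    exact P.not_dvd_index
  have hone := finrank_eq_one_of_odd hodd
  obtain ⟨n, hn⟩ := IsPGroup.iff_card.1 P.isPGroup'
  have hkL : Module.finrank k L = 2 ^ n := by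
    rw [← Module.finrank_mul_finrank k F L, hone, hFL, one_mul, hn]
  let E := IntermediateField.adjoin k {i}
  have hEL : Module.finrank E L ∣ 2 ^ n :=
    ⟨_, by rw [← hkL, ← Module.finrank_mul_finrank k E L, mul_comm]⟩
  obtain ⟨m, -, hm⟩ := (Nat.dvd_prime_pow Nat.prime_two).1 hEL
  have hcard : Nat.card (Gal(L/E)) = 2 ^ m := by rw [← hm, IsGalois.card_aut_eq_finrank]
  rcases m with _ | m
  · exact IntermediateField.finrank_eq_one_iff_eq_top.1 (by simpa using hm)
  exfalso
  obtain ⟨H, hH⟩ := Sylow.exists_subgroup_card_pow_prime (G := Gal(L/E)) 2 (n := m)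
    (by rw [hcard]; exact pow_dvd_pow _ (Nat.le_succ m))
  let Q := IntermediateField.fixedField H
  have hQL : Module.finrank Q L = 2 ^ m := by
    rw [← hH]; exact IntermediateField.finrank_fixedField_eq_card _
  have hEQ : Module.finrank E Q = 2 := by
    have h1 := Module.finrank_mul_finrank E Q L
    rw [hQL, hm, pow_succ, mul_comm] at h1
    exact Nat.eq_of_mul_eq_mul_left (by positivity) h1
  refine finrank_ne_two_of_forall_isSquare (E := E) (F := Q) (fun x => ?_) hEQ
  obtain ⟨a, b, hab⟩ := exists_eq_add_mul_of_mem_adjoin hi x.2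
  obtain ⟨s, t, hst⟩ := exists_sq_eq_add_mul (L := L) hi a b
  have hmem : algebraMap k L s + algebraMap k L t * i ∈ E :=
    add_mem (E.algebraMap_mem s) (mul_mem (E.algebraMap_mem t)
      (IntermediateField.mem_adjoin_simple_self k i))
  refine ⟨⟨_, hmem⟩, Subtype.ext ?_⟩
  rw [hab, ← hst, sq]; rfl

theorem IsRealClosed.exists_eq_add_mul {k K : Type*} [Field k] [LinearOrder k]
    [IsStrictOrderedRing k] [IsRealClosed k] [Field K] [Algebra k K] [IsAlgClosure k K] {i : K}
    (hi : i ^ 2 = -1) (x : K) : ∃ a b : k, x = algebraMap k K a + algebraMap k K b * i := by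
  have : Algebra.IsAlgebraic k K := IsAlgClosure.isAlgebraic
  have : Normal k K := IsAlgClosure.normal k K
  have : IsGalois k K := {}
  let L := FiniteGaloisIntermediateField.adjoin k {x, i}
  have hsub := FiniteGaloisIntermediateField.subset_adjoin k {x, i}
  have hx : x ∈ L.toIntermediateField := hsub (by simp)
  have hiL : i ∈ L.toIntermediateField := hsub (by simp)
  have hi' : (⟨i, hiL⟩ : L.toIntermediateField) ^ 2 = -1 := Subtype.ext hi
  have htop := adjoin_eq_top (k := k) hi'
  obtain ⟨a, b, hab⟩ := exists_eq_add_mul_of_mem_adjoin (k := k) hi' (x := ⟨x, hx⟩)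
    (by rw [htop]; trivial)
  exact ⟨a, b, congrArg Subtype.val hab⟩

/-! ### Intermediate values, Rolle and signs at infinity over a real closed field -/

section RealClosedPolynomial

open Polynomial

variable {k : Type*} [Field k] [LinearOrder k] [IsStrictOrderedRing k]

theorem IsRealClosed.exists_dvd_sq_add_sq [IsRealClosed k] {p : k[X]}
    (hp : Irreducible p) : ∃ a b : k, p ∣ (X - C a) ^ 2 + C (b ^ 2) := by
  let K := AlgebraicClosure k
  obtain ⟨i, hi⟩ := IsAlgClosed.exists_pow_nat_eq (-1 : K) (n := 2) (by norm_num)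
  obtain ⟨α, hα⟩ := IsAlgClosed.exists_aeval_eq_zero K p hp.degree_pos.ne'
  obtain ⟨a, b, rfl⟩ := exists_eq_add_mul (k := k) hi α
  refine ⟨a, b, ?_⟩
  have h1 := minpoly.eq_of_irreducible hp hα
  have h2 : p ∣ minpoly k _ := ⟨_, h1.symm⟩
  refine h2.trans (minpoly.dvd _ _ ?_)
  simp only [map_add, map_pow, map_sub, aeval_X, aeval_C]
  linear_combination (algebraMap k K b) ^ 2 * hi

/-- An irreducible polynomial with a root is linear. One without a root is a constant multiple of
some `(X - s)² + t²` and cannot change sign. -/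
theorem IsRealClosed.exists_root_of_irreducible [IsRealClosed k] {p : k[X]} (hp : Irreducible p)
    {a b : k} (hab : a ≤ b) (h : p.eval a * p.eval b < 0) : ∃ x ∈ Set.Ioo a b, p.eval x = 0 := by
  by_cases hroot : ∃ r, p.IsRoot r
  · obtain ⟨r, hr⟩ := hroot
    refine ⟨r, ?_, hr⟩
    obtain ⟨q, hq⟩ := dvd_iff_isRoot.2 hr
    have hu : IsUnit q := (hp.isUnit_or_isUnit hq).resolve_left (not_isUnit_X_sub_C r)
    obtain ⟨c, -, rfl⟩ := Polynomial.isUnit_iff.1 hu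
    have h' : (c * c) * ((a - r) * (b - r)) < 0 := by
      rw [hq] at h
      simp only [eval_mul, eval_sub, eval_X, eval_C] at h
      linarith
    have h2 : (a - r) * (b - r) < 0 := by
      by_contra h3
      exact h'.not_ge (mul_nonneg (mul_self_nonneg c) (not_lt.1 h3))
    constructor <;> nlinarith
  exfalso
  obtain ⟨s, t, q, hq⟩ := exists_dvd_sq_add_sq hp
  have hdeg : ((X - C s) ^ 2 + C (t ^ 2)).natDegree = 2 := by compute_degree!
  have hne : (X - C s) ^ 2 + C (t ^ 2) ≠ 0 := by
    intro h0; rw [h0] at hdeg; simp at hdeg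
  have hq0 : q ≠ 0 := by rintro rfl; exact hne (by simpa using hq)
  have hadd := natDegree_mul hp.ne_zero hq0
  rw [← hq, hdeg] at hadd
  have h1 : p.natDegree ≠ 1 := fun h1 =>
    hroot (exists_isRoot_of_odd_natDegree (by rw [h1]; exact odd_one))
  have h2 := hp.natDegree_pos
  obtain ⟨c, hc⟩ := natDegree_eq_zero.1 (show q.natDegree = 0 by omega)
  have ev : ∀ x, (x - s) ^ 2 + t ^ 2 = p.eval x * c := fun x => by
    simpa [← hc] using congrArg (eval x) hq
  have hc0 : c ≠ 0 := by rintro rfl; exact hq0 (by simpa using hc.symm)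
  have h3 : 0 ≤ ((a - s) ^ 2 + t ^ 2) * ((b - s) ^ 2 + t ^ 2) := by positivity
  rw [ev, ev] at h3
  have h4 : 0 < c * c := mul_self_pos.2 hc0
  nlinarith

/-- If a product changes sign, so does one of its factors; this reduces the intermediate value
theorem to irreducible polynomials. -/
theorem IsRealClosed.exists_root_of_mul_neg [IsRealClosed k] (p : k[X]) {a b : k} (hab : a ≤ b)
    (h : p.eval a * p.eval b < 0) : ∃ x ∈ Set.Ioo a b, p.eval x = 0 := by
  induction p using WfDvdMonoid.induction_on_irreducible with
  | zero => simp at h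
  | unit u hu =>
    obtain ⟨c, -, rfl⟩ := Polynomial.isUnit_iff.1 hu
    simp only [eval_C] at h
    nlinarith [mul_self_nonneg c]
  | mul q p hq hp ih =>
    rw [eval_mul, eval_mul] at h
    by_cases hq' : q.eval a * q.eval b < 0
    · obtain ⟨x, hx, hx0⟩ := ih hq'
      exact ⟨x, hx, by simp [hx0]⟩
    obtain ⟨x, hx, hx0⟩ := exists_root_of_irreducible hp hab (by nlinarith)
    exact ⟨x, hx, by simp [hx0]⟩

theorem IsRealClosed.sign_eval_eq [IsRealClosed k] {p : k[X]} {a b : k} (hab : a ≤ b)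
    (h : ∀ x ∈ Set.Icc a b, p.eval x ≠ 0) :
    SignType.sign (p.eval a) = SignType.sign (p.eval b) := by
  have ha := h a ⟨le_rfl, hab⟩
  have hb := h b ⟨hab, le_rfl⟩
  by_contra hne
  have : p.eval a * p.eval b < 0 := by
    rcases ha.lt_or_gt with ha | ha <;> rcases hb.lt_or_gt with hb | hb
    · simp [sign_neg ha, sign_neg hb] at hne
    · exact mul_neg_of_neg_of_pos ha hb
    · exact mul_neg_of_pos_of_neg ha hb
    · simp [sign_pos ha, sign_pos hb] at hne
  obtain ⟨x, hx, hx0⟩ := exists_root_of_mul_neg p hab this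
  exact h x (Set.Ioo_subset_Icc_self hx) hx0

/-- Rolle's theorem without compactness. For consecutive roots, split off the full powers of `X - a`
and `X - b`; the cofactor `r` keeps its sign on `[a, b]`, and what remains of the derivative changes
sign between `a` and `b`. -/
theorem IsRealClosed.exists_derivative_eval_eq_zero [IsRealClosed k] {p : k[X]} {a b : k}
    (hab : a < b) (ha : p.eval a = 0) (hb : p.eval b = 0) :
    ∃ x ∈ Set.Ioo a b, (derivative p).eval x = 0 := by
  rcases eq_or_ne p 0 with rfl | hp
  · obtain ⟨c, hc⟩ := exists_between hab
    exact ⟨c, hc, by simp⟩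
  -- Replace `b` by the smallest root to the right of `a`.
  wlog hmin : ∀ x ∈ Set.Ioo a b, p.eval x ≠ 0 generalizing b
  · obtain ⟨c, hc, hcmin⟩ := Finset.exists_min_image (p.roots.toFinset.filter (a < ·)) id
      ⟨b, by simp [hp, hab, hb]⟩
    simp only [Finset.mem_filter, Multiset.mem_toFinset, mem_roots hp, IsRoot, id] at hc hcmin
    have hcb : c ≤ b := hcmin b ⟨hb, hab⟩
    obtain ⟨x, hx, hx0⟩ := this hc.2 hc.1 fun x hx h0 => (hcmin x ⟨h0, hx.1⟩).not_gt hx.2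
    exact ⟨x, ⟨hx.1, hx.2.trans_le hcb⟩, hx0⟩
  obtain ⟨q, hq, hqa⟩ := exists_eq_pow_rootMultiplicity_mul_and_not_dvd p hp a
  have hm : 0 < p.rootMultiplicity a := (rootMultiplicity_pos hp).2 ha
  obtain ⟨m, hm⟩ := Nat.exists_eq_succ_of_ne_zero hm.ne'
  have hq0 : q ≠ 0 := by rintro rfl; simp at hqa
  have hqb : q.eval b = 0 := by
    rw [hq] at hb
    simpa [sub_eq_zero, hab.ne'] using hb
  obtain ⟨r, hr, hrb⟩ := exists_eq_pow_rootMultiplicity_mul_and_not_dvd q hq0 b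
  have hl : 0 < q.rootMultiplicity b := (rootMultiplicity_pos hq0).2 hqb
  obtain ⟨l, hl⟩ := Nat.exists_eq_succ_of_ne_zero hl.ne'
  rw [hm] at hq
  rw [hl] at hr
  have hra : r.eval a ≠ 0 := by
    intro h0
    apply hqa
    rw [dvd_iff_isRoot, hr]
    simp [h0]
  have hrb' : r.eval b ≠ 0 := fun h0 => hrb (dvd_iff_isRoot.2 h0)
  have hp' : p = (X - C a) ^ (m + 1) * ((X - C b) ^ (l + 1) * r) := by rw [← hr]; exact hq
  have hrI : ∀ x ∈ Set.Icc a b, r.eval x ≠ 0 := by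
    intro x hx h0
    rcases hx.1.eq_or_lt with rfl | h1
    · exact hra h0
    rcases hx.2.eq_or_lt with rfl | h2
    · exact hrb' h0
    exact hmin x ⟨h1, h2⟩ (by rw [hp']; simp [h0])
  have hs := sign_eval_eq hab.le hrI
  have hpos : 0 < r.eval a * r.eval b := by
    rw [← sign_eq_one_iff, sign_mul, ← hs, ← sign_mul, sign_eq_one_iff]
    exact mul_self_pos.2 hra
  let s : k[X] := ((m + 1 : ℕ) : k[X]) * (X - C b) * r + ((l + 1 : ℕ) : k[X]) * (X - C a) * r +
    (X - C a) * (X - C b) * derivative r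
  have hd : derivative p = (X - C a) ^ m * (X - C b) ^ l * s := by
    rw [hp']
    simp only [derivative_mul, derivative_X_sub_C_pow, s, Nat.add_sub_cancel, map_natCast]
    ring
  have hsneg : s.eval a * s.eval b < 0 := by
    have : s.eval a * s.eval b =
        -((m + 1 : ℕ) * (l + 1 : ℕ) * (b - a) ^ 2 * (r.eval a * r.eval b)) := by
      simp only [s, eval_add, eval_mul, eval_sub, eval_X, eval_C, eval_natCast]
      ring
    rw [this, neg_lt_zero]
    have : 0 < b - a := sub_pos.2 hab
    positivity
  obtain ⟨x, hx, hx0⟩ := exists_root_of_mul_neg s hab.le hsneg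
  exact ⟨x, hx, by rw [hd]; simp [hx0]⟩

theorem IsRealClosed.exists_eval_sub_eq_derivative_mul [IsRealClosed k] (p : k[X]) {a b : k}
    (hab : a < b) :
    ∃ x ∈ Set.Ioo a b, p.eval b - p.eval a = (derivative p).eval x * (b - a) := by
  have hba : b - a ≠ 0 := (sub_pos.2 hab).ne'
  obtain ⟨x, hx, h⟩ := exists_derivative_eval_eq_zero
    (p := p - C (p.eval a) - C ((p.eval b - p.eval a) / (b - a)) * (X - C a)) hab
    (by simp) (by simp [div_mul_cancel₀ _ hba])
  refine ⟨x, hx, ?_⟩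
  simp only [derivative_sub, derivative_C, derivative_C_mul, derivative_X, eval_sub,
    eval_C, sub_zero, mul_one, sub_eq_zero] at h
  rw [h, div_mul_cancel₀ _ hba]

/-- To the left of a root, a polynomial whose derivative has constant sign has the opposite
sign. -/
theorem IsRealClosed.sign_eval_eq_neg_sign_derivative [IsRealClosed k] {p : k[X]} {a b : k}
    (hab : a < b) (hb : p.eval b = 0) (h : ∀ x ∈ Set.Ico a b, (derivative p).eval x ≠ 0) :
    SignType.sign (p.eval a) = -SignType.sign ((derivative p).eval a) := by
  obtain ⟨x, hx, hx'⟩ := exists_eval_sub_eq_derivative_mul p hab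
  have h1 : p.eval a = -((derivative p).eval x * (b - a)) := by rw [← hx', hb]; ring
  rw [h1, Left.sign_neg, sign_mul, sign_pos (sub_pos.2 hab), mul_one,
    sign_eval_eq hx.1.le fun y hy => h y ⟨hy.1, hy.2.trans_lt hx.2⟩]

theorem IsRealClosed.eval_mul_eval_neg [IsRealClosed k] {p : k[X]} {a b x : k}
    (hx : x ∈ Set.Ioo a b) (hx0 : p.eval x = 0)
    (h : ∀ y ∈ Set.Ioo a b, (derivative p).eval y ≠ 0) : p.eval a * p.eval b < 0 := by
  obtain ⟨y, hy, hy'⟩ := exists_eval_sub_eq_derivative_mul p hx.1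
  obtain ⟨z, hz, hz'⟩ := exists_eval_sub_eq_derivative_mul p hx.2
  rw [hx0] at hy' hz'
  have hs := sign_eval_eq (p := derivative p) (hy.2.trans hz.1).le fun w hw =>
    h w ⟨hy.1.trans_le hw.1, hw.2.trans_lt hz.2⟩
  have hne := h y ⟨hy.1, hy.2.trans hx.2⟩
  have hpos : 0 < (derivative p).eval y * (derivative p).eval z := by
    rw [← sign_eq_one_iff, sign_mul, ← hs, ← sign_mul, sign_eq_one_iff]
    exact mul_self_pos.2 hne
  have : p.eval a * p.eval b =
      -((derivative p).eval y * (derivative p).eval z * ((x - a) * (b - x))) := by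
    linear_combination (-p.eval b) * hy' - (derivative p).eval y * (x - a) * hz'
  rw [this, neg_lt_zero]
  have h1 : 0 < x - a := sub_pos.2 hx.1
  have h2 : 0 < b - x := sub_pos.2 hx.2
  positivity

/-- A uniform bound `ε`, rather than mere positivity, is what lets the induction through `p = X *
divX p + p(0)` absorb the constant term. -/
theorem Polynomial.eventually_atTop_le_eval {p : k[X]} (hp : 0 < p.leadingCoeff) :
    ∃ ε > 0, ∀ᶠ x in Filter.atTop, ε ≤ p.eval x := by
  induction hn : p.natDegree generalizing p with
  | zero =>
    refine ⟨p.leadingCoeff, hp, Filter.Eventually.of_forall fun x => ?_⟩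
    rw [eq_C_of_natDegree_eq_zero hn]
    simp
  | succ n ih =>
    have hd : (divX p).natDegree = n := by rw [natDegree_divX_eq_natDegree_tsub_one, hn]; rfl
    have hl : (divX p).leadingCoeff = p.leadingCoeff := by
      rw [leadingCoeff, leadingCoeff, hd, hn, coeff_divX]
    obtain ⟨ε, hε, h⟩ := ih (hl ▸ hp) hd
    refine ⟨1, one_pos, ?_⟩
    filter_upwards [h, Filter.eventually_ge_atTop 0,
      Filter.eventually_ge_atTop ((1 - p.coeff 0) / ε)] with x h1 h2 h3
    rw [div_le_iff₀ hε] at h3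
    have h4 : p.eval x = (divX p).eval x * x + p.coeff 0 := by
      conv_lhs => rw [← divX_mul_X_add p]
      simp
    rw [h4]
    nlinarith [mul_le_mul_of_nonneg_right h1 h2]

theorem Polynomial.eventually_atTop_sign_eval (p : k[X]) :
    ∀ᶠ x in Filter.atTop, SignType.sign (p.eval x) = SignType.sign p.leadingCoeff := by
  rcases lt_trichotomy p.leadingCoeff 0 with h | h | h
  · obtain ⟨ε, hε, h'⟩ := eventually_atTop_le_eval (p := -p) (by simpa using h)
    filter_upwards [h'] with x hx
    rw [eval_neg] at hx
    rw [sign_neg h, sign_neg (by linarith)]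
  · simp [leadingCoeff_eq_zero.1 h]
  · obtain ⟨ε, hε, h'⟩ := eventually_atTop_le_eval h
    filter_upwards [h'] with x hx
    rw [sign_pos h, sign_pos (by linarith)]

theorem Polynomial.eventually_atBot_sign_eval (p : k[X]) :
    ∀ᶠ x in Filter.atBot, SignType.sign (p.eval x) =
      (-1) ^ p.natDegree * SignType.sign p.leadingCoeff := by
  have h := Filter.tendsto_neg_atBot_atTop.eventually (eventually_atTop_sign_eval (p.comp (-X)))
  have hl : (p.comp (-X)).leadingCoeff = (-1) ^ p.natDegree * p.leadingCoeff := by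
    rw [leadingCoeff_comp (by simp)]; simp [mul_comm]
  filter_upwards [h] with x hx
  rw [hl, sign_mul, sign_pow] at hx
  simpa using hx

end RealClosedPolynomial

/-! ### Order automorphisms of the line that match signs of polynomials -/

section OrderIsoExtension

set_option linter.unusedSectionVars false

open Polynomial

variable {k : Type*} [Field k] [LinearOrder k] [IsStrictOrderedRing k]

/-- The piecewise linear map that fixes the complement of the interval `(c, d)` and sends its
point `e` to `e'`. -/
def piecewiseLinearMove (c d e e' x : k) : k :=
  if x ≤ c then x else if x ≤ e then c + (x - c) * ((e' - c) / (e - c))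
  else if x ≤ d then d - (d - x) * ((d - e') / (d - e)) else x

theorem piecewiseLinearMove_of_notMem {c d e e' x : k} (he : e ∈ Set.Ioo c d)
    (hx : x ∉ Set.Ioo c d) : piecewiseLinearMove c d e e' x = x := by
  unfold piecewiseLinearMove
  rw [Set.mem_Ioo, not_and_or, not_lt, not_lt] at hx
  have := he.1
  have := he.2
  split_ifs with h1 h2 h3
  · rfl
  · rcases hx with hx | hx <;> exfalso <;> linarith
  · have : x = d := by rcases hx with hx | hx <;> [exact absurd hx h1; exact le_antisymm h3 hx]
    simp [this]
  · rfl

theorem piecewiseLinearMove_apply {c d e e' : k} (he : e ∈ Set.Ioo c d) :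
    piecewiseLinearMove c d e e' e = e' := by
  have := (sub_pos.2 he.1).ne'
  simp [piecewiseLinearMove, he.1.not_ge, mul_div_cancel₀ _ this]

theorem piecewiseLinearMove_left {c d e e' x : k} (he : e ∈ Set.Ioo c d) (he' : e' ∈ Set.Ioo c d)
    (hx : x ∈ Set.Ioc c e) :
    piecewiseLinearMove c d e e' x = c + (x - c) * ((e' - c) / (e - c)) ∧
      piecewiseLinearMove c d e e' x ∈ Set.Ioc c e' := by
  have h : piecewiseLinearMove c d e e' x = c + (x - c) * ((e' - c) / (e - c)) := by
    simp [piecewiseLinearMove, hx.1.not_ge, hx.2]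
  have h1 : 0 < e - c := sub_pos.2 he.1
  have h2 : 0 < e' - c := sub_pos.2 he'.1
  have h3 : 0 < x - c := sub_pos.2 hx.1
  refine ⟨h, ?_, ?_⟩ <;> rw [h]
  · have : 0 < (x - c) * ((e' - c) / (e - c)) := by positivity
    linarith
  · have : (x - c) * ((e' - c) / (e - c)) ≤ (e - c) * ((e' - c) / (e - c)) :=
      mul_le_mul_of_nonneg_right (by linarith [hx.2]) (by positivity)
    rw [mul_div_cancel₀ _ h1.ne'] at this
    linarith

theorem piecewiseLinearMove_right {c d e e' x : k} (he : e ∈ Set.Ioo c d) (he' : e' ∈ Set.Ioo c d)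
    (hx : x ∈ Set.Ioc e d) :
    piecewiseLinearMove c d e e' x = d - (d - x) * ((d - e') / (d - e)) ∧
      piecewiseLinearMove c d e e' x ∈ Set.Ioc e' d := by
  have h : piecewiseLinearMove c d e e' x = d - (d - x) * ((d - e') / (d - e)) := by
    simp [piecewiseLinearMove, hx.1.not_ge, hx.2, (he.1.trans hx.1).not_ge]
  have h1 : 0 < d - e := sub_pos.2 he.2
  have h2 : 0 < d - e' := sub_pos.2 he'.2
  have h3 : 0 ≤ d - x := sub_nonneg.2 hx.2
  refine ⟨h, ?_, ?_⟩ <;> rw [h]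
  · have : (d - x) * ((d - e') / (d - e)) < (d - e) * ((d - e') / (d - e)) :=
      mul_lt_mul_of_pos_right (by linarith [hx.1]) (by positivity)
    rw [mul_div_cancel₀ _ h1.ne'] at this
    linarith
  · have : 0 ≤ (d - x) * ((d - e') / (d - e)) := by positivity
    linarith

theorem piecewiseLinearMove_cases {c d e : k} (x : k) :
    x ∉ Set.Ioc c d ∨ x ∈ Set.Ioc c e ∨ x ∈ Set.Ioc e d := by
  simp only [Set.mem_Ioc, not_and, not_le]
  rcases le_or_gt x c with h | h
  · exact .inl fun h' => absurd h' h.not_gt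
  rcases le_or_gt x e with h' | h'
  · exact .inr (.inl ⟨h, h'⟩)
  rcases le_or_gt x d with h'' | h''
  · exact .inr (.inr ⟨h', h''⟩)
  · exact .inl fun _ => h''

theorem piecewiseLinearMove_inverse {c d e e' : k} (he : e ∈ Set.Ioo c d)
    (he' : e' ∈ Set.Ioo c d) (x : k) :
    piecewiseLinearMove c d e' e (piecewiseLinearMove c d e e' x) = x := by
  rcases piecewiseLinearMove_cases (c := c) (d := d) (e := e) x with h | h | h
  · have h : x ∉ Set.Ioo c d := fun h' => h (Set.Ioo_subset_Ioc_self h')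
    rw [piecewiseLinearMove_of_notMem he h, piecewiseLinearMove_of_notMem he' h]
  · obtain ⟨h1, h2⟩ := piecewiseLinearMove_left he he' h
    rw [(piecewiseLinearMove_left he' he h2).1, h1]
    have := (sub_pos.2 he.1).ne'
    have := (sub_pos.2 he'.1).ne'
    field_simp
    ring
  · obtain ⟨h1, h2⟩ := piecewiseLinearMove_right he he' h
    rw [(piecewiseLinearMove_right he' he h2).1, h1]
    have := (sub_pos.2 he.2).ne'
    have := (sub_pos.2 he'.2).ne'
    field_simp
    ring

theorem piecewiseLinearMove_strictMono {c d e e' : k} (he : e ∈ Set.Ioo c d)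
    (he' : e' ∈ Set.Ioo c d) : StrictMono (piecewiseLinearMove c d e e') := by
  have outer : ∀ x, x ∉ Set.Ioc c d → piecewiseLinearMove c d e e' x = x ∧ (x ≤ c ∨ d < x) := by
    intro x hx
    refine ⟨piecewiseLinearMove_of_notMem he fun h => hx (Set.Ioo_subset_Ioc_self h), ?_⟩
    rwa [Set.mem_Ioc, not_and_or, not_lt, not_le] at hx
  have h1 : 0 < e - c := sub_pos.2 he.1
  have h2 : 0 < e' - c := sub_pos.2 he'.1
  have h3 : 0 < d - e := sub_pos.2 he.2
  have h4 : 0 < d - e' := sub_pos.2 he'.2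
  intro x y hxy
  rcases piecewiseLinearMove_cases (c := c) (d := d) (e := e) x with hx | hx | hx <;>
  rcases piecewiseLinearMove_cases (c := c) (d := d) (e := e) y with hy | hy | hy
  · rwa [(outer x hx).1, (outer y hy).1]
  · obtain ⟨-, h⟩ := piecewiseLinearMove_left he he' hy
    obtain ⟨hx1, hx2 | hx2⟩ := outer x hx <;> rw [hx1] <;> linarith [h.1, hy.2]
  · obtain ⟨-, h⟩ := piecewiseLinearMove_right he he' hy
    obtain ⟨hx1, hx2 | hx2⟩ := outer x hx <;> rw [hx1] <;> linarith [h.1, hy.2]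
  · obtain ⟨-, h⟩ := piecewiseLinearMove_left he he' hx
    obtain ⟨hy1, hy2 | hy2⟩ := outer y hy <;> rw [hy1] <;> linarith [h.2, hx.1]
  · rw [(piecewiseLinearMove_left he he' hx).1, (piecewiseLinearMove_left he he' hy).1]
    have : (x - c) * ((e' - c) / (e - c)) < (y - c) * ((e' - c) / (e - c)) :=
      mul_lt_mul_of_pos_right (by linarith) (by positivity)
    linarith
  · linarith [(piecewiseLinearMove_left he he' hx).2.2, (piecewiseLinearMove_right he he' hy).2.1]
  · obtain ⟨-, h⟩ := piecewiseLinearMove_right he he' hx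
    obtain ⟨hy1, hy2 | hy2⟩ := outer y hy <;> rw [hy1] <;> linarith [h.2, hx.1]
  · linarith [hx.1, hy.2]
  · rw [(piecewiseLinearMove_right he he' hx).1, (piecewiseLinearMove_right he he' hy).1]
    have : (d - y) * ((d - e') / (d - e)) < (d - x) * ((d - e') / (d - e)) :=
      mul_lt_mul_of_pos_right (by linarith) (by positivity)
    linarith

theorem exists_orderIso_move {c d e e' : k} (he : e ∈ Set.Ioo c d) (he' : e' ∈ Set.Ioo c d) :
    ∃ φ : k ≃o k, φ e = e' ∧ ∀ x ∉ Set.Ioo c d, φ x = x :=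
  ⟨(piecewiseLinearMove_strictMono he he').orderIsoOfRightInverse _
      (piecewiseLinearMove c d e' e) (piecewiseLinearMove_inverse he' he),
    piecewiseLinearMove_apply he, fun _ => piecewiseLinearMove_of_notMem he⟩

/-- The order automorphism `h` carries the signs of `P` to the signs of `Q`. -/
def SignCompatible (h : k ≃o k) (P Q : k[X]) : Prop :=
  ∀ x, SignType.sign (P.eval x) = SignType.sign (Q.eval (h x))

theorem SignCompatible.symm {h : k ≃o k} {P Q : k[X]} (H : SignCompatible h P Q) :
    SignCompatible h.symm Q P := fun x => by rw [H (h.symm x), h.apply_symm_apply]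

theorem SignCompatible.eval_eq_zero_iff {h : k ≃o k} {P Q : k[X]} (H : SignCompatible h P Q)
    (x : k) : P.eval x = 0 ↔ Q.eval (h x) = 0 := by
  rw [← sign_eq_zero_iff, H x, sign_eq_zero_iff]

/-- Take the nearest point of `Z` to the left of `x`; if there is none, a point so far left that the
signs are those at `-∞`, where the parity of the degree enters. -/
theorem exists_left_sign_eq {h : k ≃o k} {P Q : k[X]} {Z : Set k} (hZ : Z.Finite)
    (hs : ∀ z ∈ Z, SignType.sign (P.eval z) = SignType.sign (Q.eval (h z)))
    (hdeg : P.natDegree = Q.natDegree)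
    (hlc : SignType.sign P.leadingCoeff = SignType.sign Q.leadingCoeff) (x : k) :
    ∃ a < x, (∀ y ∈ Set.Ioo a x, y ∉ Z) ∧
      SignType.sign (P.eval a) = SignType.sign (Q.eval (h a)) := by
  by_cases hne : (hZ.toFinset.filter (· < x)).Nonempty
  · obtain ⟨a, ha, hmax⟩ := Finset.exists_max_image _ id hne
    simp only [Finset.mem_filter, Set.Finite.mem_toFinset, id] at ha hmax
    exact ⟨a, ha.2, fun y hy hyZ => (hmax y ⟨hyZ, hy.2⟩).not_gt hy.1, hs a ha.1⟩
  · obtain ⟨a, h1, h2, h3⟩ := ((eventually_atBot_sign_eval P).and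
      ((h.tendsto_atBot.eventually (eventually_atBot_sign_eval Q)).and
        (Filter.eventually_lt_atBot x))).exists
    refine ⟨a, h3, fun y hy hyZ => hne ⟨y, ?_⟩, by rw [h1, h2, hdeg, hlc]⟩
    simpa using ⟨hyZ, hy.2⟩

theorem exists_right_sign_eq {h : k ≃o k} {P Q : k[X]} {Z : Set k} (hZ : Z.Finite)
    (hs : ∀ z ∈ Z, SignType.sign (P.eval z) = SignType.sign (Q.eval (h z)))
    (hlc : SignType.sign P.leadingCoeff = SignType.sign Q.leadingCoeff) (x : k) :
    ∃ b > x, (∀ y ∈ Set.Ioo x b, y ∉ Z) ∧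
      SignType.sign (P.eval b) = SignType.sign (Q.eval (h b)) := by
  by_cases hne : (hZ.toFinset.filter (x < ·)).Nonempty
  · obtain ⟨a, ha, hmin⟩ := Finset.exists_min_image _ id hne
    simp only [Finset.mem_filter, Set.Finite.mem_toFinset, id] at ha hmin
    exact ⟨a, ha.2, fun y hy hyZ => (hmin y ⟨hyZ, hy.1⟩).not_gt hy.2, hs a ha.1⟩
  · obtain ⟨a, h1, h2, h3⟩ := ((eventually_atTop_sign_eval P).and
      ((h.tendsto_atTop.eventually (eventually_atTop_sign_eval Q)).and
        (Filter.eventually_gt_atTop x))).exists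
    refine ⟨a, h3, fun y hy hyZ => hne ⟨y, ?_⟩, by rw [h1, h2, hlc]⟩
    simpa using ⟨hyZ, hy.1⟩

/-- Between neighbouring points of `Z` the derivative of `P` has no root, so `P` changes sign across
`ξ`. The signs of `Q` at the images of the endpoints are the same, so `Q` has a root between them.
-/
theorem exists_root_transfer [IsRealClosed k] {h : k ≃o k} {P Q : k[X]} {Z : Set k}
    (hZ : Z.Finite) (hs : ∀ z ∈ Z, SignType.sign (P.eval z) = SignType.sign (Q.eval (h z)))
    (hdeg : P.natDegree = Q.natDegree)
    (hlc : SignType.sign P.leadingCoeff = SignType.sign Q.leadingCoeff)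
    (hder : ∀ x, (derivative P).eval x = 0 → x ∈ Z) {ξ : k} (hξ : ξ ∉ Z) (h0 : P.eval ξ = 0) :
    ∃ a b, ξ ∈ Set.Ioo a b ∧ (∀ x ∈ Set.Ioo a b, x ∉ Z) ∧
      ∃ η ∈ Set.Ioo (h a) (h b), Q.eval η = 0 := by
  obtain ⟨a, ha, haZ, has⟩ := exists_left_sign_eq hZ hs hdeg hlc ξ
  obtain ⟨b, hb, hbZ, hbs⟩ := exists_right_sign_eq hZ hs hlc ξ
  have hZ' : ∀ x ∈ Set.Ioo a b, x ∉ Z := by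
    intro x hx
    rcases lt_trichotomy x ξ with h | rfl | h
    · exact haZ x ⟨hx.1, h⟩
    · exact hξ
    · exact hbZ x ⟨h, hx.2⟩
  refine ⟨a, b, ⟨ha, hb⟩, hZ', ?_⟩
  have hneg := IsRealClosed.eval_mul_eval_neg (x := ξ) ⟨ha, hb⟩ h0
    fun y hy hy0 => hZ' y hy (hder y hy0)
  refine IsRealClosed.exists_root_of_mul_neg Q (h.monotone (ha.trans hb).le) ?_
  rwa [← sign_eq_neg_one_iff, sign_mul, ← has, ← hbs, ← sign_mul, sign_eq_neg_one_iff]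

theorem eq_of_roots_of_derivative_ne_zero [IsRealClosed k] {P : k[X]} {a b x y : k}
    (h : ∀ z ∈ Set.Ioo a b, (derivative P).eval z ≠ 0) (hx : x ∈ Set.Ioo a b)
    (hy : y ∈ Set.Ioo a b) (hx0 : P.eval x = 0) (hy0 : P.eval y = 0) : x = y := by
  wlog hxy : x < y generalizing x y
  · rcases eq_or_lt_of_not_gt hxy with h | h
    · exact h.symm
    · exact (this hy hx hy0 hx0 h).symm
  obtain ⟨z, hz, hz0⟩ := IsRealClosed.exists_derivative_eval_eq_zero hxy hx0 hy0
  exact absurd hz0 (h z ⟨hx.1.trans hz.1, hz.2.trans hy.2⟩)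

/-- Moving one point inside an interval without roots does not affect sign compatibility. -/
theorem SignCompatible.trans_of_fixed [IsRealClosed k] {h φ : k ≃o k} {P Q : k[X]} {a b : k}
    (H : SignCompatible h P Q) (hφ : ∀ x ∉ Set.Ioo (h a) (h b), φ x = x)
    (hP : P ≠ 0 → ∀ x ∈ Set.Ioo a b, P.eval x ≠ 0) : SignCompatible (h.trans φ) P Q := by
  intro x
  rw [OrderIso.trans_apply]
  rcases eq_or_ne P 0 with rfl | hP0
  · have := H (h.symm (φ (h x)))
    rw [h.apply_symm_apply] at this
    simpa using this
  rw [H x]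
  by_cases hx : h x ∈ Set.Ioo (h a) (h b)
  · have hx' : φ (h x) ∈ Set.Ioo (h a) (h b) := by
      have ha := hφ (h a) (by simp)
      have hb := hφ (h b) (by simp)
      exact ⟨by rw [← ha]; exact φ.strictMono hx.1, by rw [← hb]; exact φ.strictMono hx.2⟩
    have hQ : ∀ y ∈ Set.Ioo (h a) (h b), Q.eval y ≠ 0 := by
      intro y hy hy0
      obtain ⟨z, rfl⟩ := h.surjective y
      exact hP hP0 z ⟨h.lt_iff_lt.1 hy.1, h.lt_iff_lt.1 hy.2⟩ ((H.eval_eq_zero_iff z).2 hy0)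
    rcases le_total (h x) (φ (h x)) with hle | hle
    · exact IsRealClosed.sign_eval_eq hle fun y hy =>
        hQ y ⟨hx.1.trans_le hy.1, hy.2.trans_lt hx'.2⟩
    · exact (IsRealClosed.sign_eval_eq hle fun y hy =>
        hQ y ⟨hx'.1.trans_le hy.1, hy.2.trans_lt hx.2⟩).symm
  · rw [hφ _ hx]

/-- Induction on the number of roots of `P` not yet sent to roots of `Q`. Each is corrected by a
move supported in the image of an interval that avoids `Z`; `P` has no other root in that interval,
so nothing already matched is spoiled. -/
theorem exists_orderIso_roots [IsRealClosed k] {G : Set (k[X] × k[X])} {P Q : k[X]} {Z : Set k}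
    (hZ : Z.Finite) (hGZ : ∀ g ∈ G, g.1 ≠ 0 → ∀ x, g.1.eval x = 0 → x ∈ Z)
    (hP : P ≠ 0) (hdeg : P.natDegree = Q.natDegree)
    (hlc : SignType.sign P.leadingCoeff = SignType.sign Q.leadingCoeff)
    (hder : ∀ x, (derivative P).eval x = 0 → x ∈ Z) (n : ℕ) (h : k ≃o k)
    (hG : ∀ g ∈ G, SignCompatible h g.1 g.2)
    (hs : ∀ z ∈ Z, SignType.sign (P.eval z) = SignType.sign (Q.eval (h z)))
    (hn : (P.roots.toFinset.filter fun x => Q.eval (h x) ≠ 0).card ≤ n) :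
    ∃ h' : k ≃o k, (∀ g ∈ G, SignCompatible h' g.1 g.2) ∧
      (∀ z ∈ Z, SignType.sign (P.eval z) = SignType.sign (Q.eval (h' z))) ∧
      ∀ x, P.eval x = 0 → Q.eval (h' x) = 0 := by
  induction n generalizing h with
  | zero =>
    refine ⟨h, hG, hs, fun x hx => ?_⟩
    by_contra hx'
    have := Finset.card_eq_zero.1 (Nat.le_zero.1 hn)
    exact Finset.notMem_empty x (this ▸ by simpa [hP] using ⟨hx, hx'⟩)
  | succ n ih =>
    by_cases hbad : ∀ x, P.eval x = 0 → Q.eval (h x) = 0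
    · exact ⟨h, hG, hs, hbad⟩
    push Not at hbad
    obtain ⟨ξ, hξ, hξ'⟩ := hbad
    have hξZ : ξ ∉ Z := fun hz => hξ' (by
      have := hs ξ hz
      rwa [hξ, sign_zero, eq_comm, sign_eq_zero_iff] at this)
    obtain ⟨a, b, hξab, hab, η, hη, hη0⟩ := exists_root_transfer hZ hs hdeg hlc hder hξZ hξ
    obtain ⟨φ, hφ, hφ'⟩ := exists_orderIso_move (e := h ξ)
      ⟨h.strictMono hξab.1, h.strictMono hξab.2⟩ hη
    have hmem : ∀ x, h x ∈ Set.Ioo (h a) (h b) → x ∈ Set.Ioo a b := fun x hx =>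
      ⟨h.lt_iff_lt.1 hx.1, h.lt_iff_lt.1 hx.2⟩
    refine ih (h.trans φ) (fun g hg => (hG g hg).trans_of_fixed hφ' fun hg0 x hx hx0 =>
      hab x hx (hGZ g hg hg0 x hx0)) (fun z hz => ?_) ?_
    · rw [OrderIso.trans_apply, hφ' _ fun hz' => hab z (hmem z hz') hz]
      exact hs z hz
    · refine Nat.le_of_lt_succ (lt_of_lt_of_le (Finset.card_lt_card ?_) hn)
      rw [Finset.ssubset_iff_of_subset]
      · exact ⟨ξ, by simpa [hP] using ⟨hξ, hξ'⟩, fun hm =>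
          (Finset.mem_filter.1 hm).2 (by rw [OrderIso.trans_apply, hφ, hη0])⟩
      · intro x hx
        obtain ⟨hx0, hx1⟩ := Finset.mem_filter.1 hx
        refine Finset.mem_filter.2 ⟨hx0, ?_⟩
        rw [Multiset.mem_toFinset, mem_roots hP] at hx0
        rw [OrderIso.trans_apply] at hx1
        by_cases hx' : h x ∈ Set.Ioo (h a) (h b)
        · have := eq_of_roots_of_derivative_ne_zero
            (fun z hz hz0 => hab z hz (hder z hz0)) (hmem x hx') hξab hx0 hξ
          rw [this]; exact hξ'
        · rw [← hφ' _ hx']; exact hx1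

/-- The sign of `P` at a non-root `x` persists up to the next root `ξ`, and just before `ξ` it is
opposite to the sign of the derivative. If no root follows, it is the sign of the leading
coefficient. All these data are transported by `h`. -/
theorem SignCompatible.of_roots [IsRealClosed k] {h : k ≃o k} {P Q : k[X]}
    (hP : derivative P ≠ 0) (hder : SignCompatible h (derivative P) (derivative Q))
    (hlc : SignType.sign P.leadingCoeff = SignType.sign Q.leadingCoeff)
    (hroot : ∀ x, P.eval x = 0 ↔ Q.eval (h x) = 0) : SignCompatible h P Q := by
  have hP0 : P ≠ 0 := by rintro rfl; simp at hP
  intro x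
  by_cases hx : P.eval x = 0
  · rw [hx, (hroot x).1 hx]
  have key : ∀ y, x ≤ y → (∀ z ∈ Set.Icc x y, P.eval z ≠ 0) →
      SignType.sign (P.eval y) = SignType.sign (Q.eval (h y)) →
      SignType.sign (P.eval x) = SignType.sign (Q.eval (h x)) := by
    intro y hxy hy hs
    rw [IsRealClosed.sign_eval_eq hxy hy, hs,
      IsRealClosed.sign_eval_eq (h.monotone hxy) fun w hw hw0 => ?_]
    obtain ⟨z, rfl⟩ := h.surjective w
    exact hy z ⟨h.le_iff_le.1 hw.1, h.le_iff_le.1 hw.2⟩ ((hroot z).2 hw0)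
  by_cases hne : (P.roots.toFinset.filter (x < ·)).Nonempty
  · obtain ⟨ξ, hξ, hmin⟩ := Finset.exists_min_image _ id hne
    simp only [Finset.mem_filter, Multiset.mem_toFinset, mem_roots hP0, IsRoot, id] at hξ hmin
    -- `z` is the last root of the derivative before `ξ`, or `x` if that is further right, so the
    -- derivative has no root strictly between `z` and `ξ`.
    obtain ⟨z, hz, hmax⟩ := Finset.exists_max_image
      (insert x ((derivative P).roots.toFinset.filter (· < ξ))) id ⟨x, by simp⟩
    simp only [Finset.mem_insert, Finset.mem_filter, Multiset.mem_toFinset, mem_roots hP, IsRoot,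
      id] at hz hmax
    have hxz : x ≤ z := hmax x (.inl rfl)
    have hzξ : z < ξ := by
      rcases hz with rfl | hz
      · exact hξ.2
      · exact hz.2
    obtain ⟨y, hzy, hyξ⟩ := exists_between hzξ
    have hd : ∀ w ∈ Set.Ico y ξ, (derivative P).eval w ≠ 0 := fun w hw h0 =>
      (hmax w (.inr ⟨h0, hw.2⟩)).not_gt (hzy.trans_le hw.1)
    refine key y (hxz.trans hzy.le) (fun w hw h0 => ?_) ?_
    · rcases hw.1.eq_or_lt with rfl | hlt
      · exact hx h0
      · exact (hmin w ⟨h0, hlt⟩).not_gt (hw.2.trans_lt hyξ)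
    · rw [IsRealClosed.sign_eval_eq_neg_sign_derivative hyξ hξ.1 hd, hder y,
        IsRealClosed.sign_eval_eq_neg_sign_derivative (h.strictMono hyξ) ((hroot ξ).1 hξ.1)]
      intro w hw hw0
      obtain ⟨w, rfl⟩ := h.surjective w
      exact hd w ⟨h.le_iff_le.1 hw.1, h.lt_iff_lt.1 hw.2⟩ ((hder.eval_eq_zero_iff w).2 hw0)
  · obtain ⟨y, h1, h2, h3⟩ := ((eventually_atTop_sign_eval P).and
      ((h.tendsto_atTop.eventually (eventually_atTop_sign_eval Q)).and
        (Filter.eventually_gt_atTop x))).exists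
    refine key y h3.le (fun w hw h0 => ?_) (by rw [h1, h2, hlc])
    rcases hw.1.eq_or_lt with rfl | hlt
    · exact hx h0
    · exact hne ⟨w, by simpa [hP0] using ⟨h0, hlt⟩⟩

/-- An order automorphism compatible with a finite family of pairs of polynomials can be changed
so as to be compatible with one more pair `(P, Q)`, provided that the family contains the pair of
derivatives and the signs of `P` and `Q` agree at infinity and at the roots of the family. -/
theorem exists_signCompatible_extension [IsRealClosed k] {G : Set (k[X] × k[X])} (hGf : G.Finite)
    {h : k ≃o k} (hG : ∀ g ∈ G, SignCompatible h g.1 g.2) {P Q : k[X]}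
    (hder : (derivative P, derivative Q) ∈ G) (hdeg : P.natDegree = Q.natDegree)
    (hlc : SignType.sign P.leadingCoeff = SignType.sign Q.leadingCoeff)
    (hs : ∀ g ∈ G, g.1 ≠ 0 → ∀ x, g.1.eval x = 0 →
      SignType.sign (P.eval x) = SignType.sign (Q.eval (h x))) :
    ∃ h' : k ≃o k, (∀ g ∈ G, SignCompatible h' g.1 g.2) ∧ SignCompatible h' P Q := by
  by_cases hP' : derivative P = 0
  · refine ⟨h, hG, fun x => ?_⟩
    have h1 := derivative_eq_zero.1 hP'
    have h2 := hdeg ▸ h1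
    rw [eq_C_of_natDegree_eq_zero h1, eq_C_of_natDegree_eq_zero h2] at hlc ⊢
    simpa using hlc
  have hP : P ≠ 0 := by rintro rfl; simp at hP'
  let Z : Set k := ⋃ g ∈ G, {x | g.1 ≠ 0 ∧ g.1.eval x = 0}
  have hZ : Z.Finite := by
    refine hGf.biUnion fun g _ => ?_
    by_cases hg : g.1 = 0
    · simp [hg]
    · refine (g.1.roots.toFinset.finite_toSet).subset fun x hx => ?_
      simpa [hg] using hx.2
  have hGZ : ∀ g ∈ G, g.1 ≠ 0 → ∀ x, g.1.eval x = 0 → x ∈ Z := fun g hg h1 x hx =>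
    Set.mem_biUnion hg ⟨h1, hx⟩
  have hsZ : ∀ z ∈ Z, SignType.sign (P.eval z) = SignType.sign (Q.eval (h z)) := by
    intro z hz
    obtain ⟨g, hg, h1, h2⟩ := Set.mem_iUnion₂.1 hz
    exact hs g hg h1 z h2
  have hderZ := hGZ _ hder hP'
  obtain ⟨h', hG', hs', hroot⟩ :=
    exists_orderIso_roots hZ hGZ hP hdeg hlc hderZ _ h hG hsZ le_rfl
  have hd' : SignCompatible h' (derivative P) (derivative Q) := hG' _ hder
  refine ⟨h', hG', SignCompatible.of_roots hP' hd' hlc fun x => ⟨hroot x, fun hx => ?_⟩⟩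
  by_cases hxZ : x ∈ Z
  · rw [← sign_eq_zero_iff, hs' x hxZ, hx, sign_zero]
  have hder' : ∀ y, (derivative Q).eval y = 0 → y ∈ h'.symm ⁻¹' Z := fun y hy => by
    exact hderZ _ ((hd'.symm.eval_eq_zero_iff y).1 hy)
  -- The converse: with the roles of `P` and `Q` exchanged, a root `ξ` of `P` appears whose image is
  -- a root of `Q` in the same interval as `h' x`. The derivative of `Q` has no root there, so the
  -- two points coincide.
  obtain ⟨a, b, hab, habZ, ξ, hξ, hξ0⟩ := exists_root_transfer (h := h'.symm) (P := Q) (Q := P)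
    (Z := h'.symm ⁻¹' Z) (hZ.preimage h'.symm.injective.injOn)
    (fun z hz => by rw [hs' _ hz, h'.apply_symm_apply]) hdeg.symm hlc.symm hder'
    (ξ := h' x) (by simpa using hxZ) hx
  have hmem : h' ξ ∈ Set.Ioo a b := ⟨h'.symm_apply_lt.1 hξ.1, h'.lt_symm_apply.1 hξ.2⟩
  have := eq_of_roots_of_derivative_ne_zero (fun z hz hz0 => habZ z hz (hder' z hz0)) hab hmem hx
    (hroot ξ hξ0)
  rw [h'.injective this]; exact hξ0

end OrderIsoExtension

/-! ### Sign control by coefficients and the Tarski–Seidenberg theorem -/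

section Elimination

set_option linter.unusedSectionVars false

open Polynomial

theorem Polynomial.natDegree_le_of_degree_lt_succ {R : Type*} [Semiring R] {p : R[X]} {n : ℕ}
    (h : p.degree < (n + 1 : ℕ)) : p.natDegree ≤ n :=
  natDegree_le_iff_coeff_eq_zero.2 fun i hi => (degree_lt_iff_coeff_zero _ _).1 h i hi

/-- Division with the denominators cleared. The exponent is even so that, where `g.coeff j`
specializes to a nonzero value, the factor is positive and does not affect signs. -/
theorem Polynomial.exists_pseudo_division {R : Type*} [CommRing R] (p : R[X]) {g : R[X]} {j : ℕ}
    (hg : g.natDegree ≤ j) :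
    ∃ (N : ℕ) (q r : R[X]), C (g.coeff j ^ (2 * N)) * p = q * g + r ∧ r.degree < j := by
  obtain ⟨m, hm⟩ : ∃ m : ℕ, p.degree < (j + m : ℕ) :=
    ⟨p.natDegree + 1, (degree_le_natDegree).trans_lt (by exact_mod_cast (by omega))⟩
  induction m generalizing p with
  | zero => exact ⟨0, 0, p, by simp, hm⟩
  | succ m ih =>
    let c := g.coeff j
    have hp : p.natDegree ≤ j + m := natDegree_le_of_degree_lt_succ hm
    let p' := C (c ^ 2) * p - C (c * p.coeff (j + m)) * (X ^ m * g)
    have hp' : p'.degree < (j + m : ℕ) := by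
      rw [degree_lt_iff_coeff_zero]
      intro i hi
      simp only [p', coeff_sub, coeff_C_mul]
      rcases hi.eq_or_lt with rfl | hi
      · rw [coeff_X_pow_mul]; ring
      · rw [coeff_eq_zero_of_natDegree_lt (hp.trans_lt hi)]
        obtain ⟨d, rfl⟩ : ∃ d, i = d + m := ⟨i - m, by omega⟩
        rw [coeff_X_pow_mul, coeff_eq_zero_of_natDegree_lt (show g.natDegree < d by omega)]
        ring
    obtain ⟨N, q, r, hqr, hr⟩ := ih p' hp'
    refine ⟨N + 1, q + C (c ^ (2 * N) * (c * p.coeff (j + m))) * X ^ m, r, ?_, hr⟩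
    simp only [p', map_mul, map_pow] at hqr ⊢
    linear_combination hqr

variable {k : Type*} [Field k] [LinearOrder k] [IsStrictOrderedRing k]
variable {V W R : Type*} [CommRing R]

/-- The sign behaviour of the specializations of the polynomials in `F` is determined, up to order
automorphisms of the line, by the signs of finitely many elements of the coefficient ring. -/
def SignControlled (ev : V → R →+* k) (F : Set R[X]) : Prop :=
  ∃ A : Set R, A.Finite ∧ ∀ v w,
    (∀ a ∈ A, SignType.sign (ev v a) = SignType.sign (ev w a)) →
      ∃ h : k ≃o k, ∀ f ∈ F, SignCompatible h (f.map (ev v)) (f.map (ev w))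

theorem Polynomial.map_trunc_eq {ev : R →+* k} {g : R[X]} {j : ℕ}
    (h : ∀ i, j < i → ev (g.coeff i) = 0) :
    (PowerSeries.trunc (j + 1) (g : PowerSeries R)).map ev = g.map ev := by
  ext i
  rw [coeff_map, coeff_map, PowerSeries.coeff_trunc, coeff_coe]
  split_ifs with hi
  · rfl
  · rw [h i (by omega), map_zero]

/-- At a root of `g`, the sign of `p` is the sign of a pseudo-remainder of `p` modulo `g`. -/
theorem Polynomial.sign_eval_eq_sign_remainder {ev : R →+* k} {p g q r : R[X]} {c : R} {N : ℕ}
    (h : C (c ^ (2 * N)) * p = q * g + r) (hc : ev c ≠ 0) {x : k} (hx : (g.map ev).eval x = 0) :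
    SignType.sign ((p.map ev).eval x) = SignType.sign ((r.map ev).eval x) := by
  have := congrArg (fun f => (f.map ev).eval x) h
  simp only [Polynomial.map_mul, Polynomial.map_add, eval_mul, eval_add, hx, mul_zero, zero_add,
    map_C, eval_C] at this
  rw [← this, sign_mul, map_pow, sign_pos ((even_two_mul N).pow_pos hc), one_mul]

/-- If the coefficient of degree `n` specializes to zero, `p` may be replaced by `p.erase n`.
Otherwise the degree and leading sign of `p` are known, and its sign at a root of a specialized `g`
is that of a pseudo-remainder. As the degree `j` of that specialization is not known beforehand,
remainders are needed modulo every truncation of `g`. -/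
theorem SignControlled.of_remainders [IsRealClosed k] {ev : V → R →+* k} {n : ℕ}
    {G M : Set R[X]} {p : R[X]} (hGf : G.Finite) (hGn : ∀ g ∈ G, g.natDegree ≤ n)
    (hpn : p.natDegree ≤ n) (hder : derivative p ∈ G)
    (hrem : ∀ g ∈ G, ∀ j ≤ n, ∃ (N : ℕ) (q r : R[X]), r ∈ M ∧
      C (g.coeff j ^ (2 * N)) * p = q * PowerSeries.trunc (j + 1) (g : PowerSeries R) + r)
    (hGM : SignControlled ev (G ∪ M))
    (herase : SignControlled ev (insert (p.erase n) G)) : SignControlled ev (insert p G) := by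
  obtain ⟨A, hA, hA'⟩ := hGM
  obtain ⟨B, hB, hB'⟩ := herase
  refine ⟨A ∪ B ∪ {p.coeff n} ∪ Set.image2 coeff G (Set.Iic n),
    ((hA.union hB).union (Set.finite_singleton _)).union (hGf.image2 _ (Set.finite_Iic n)),
    fun v w hvw => ?_⟩
  have hc := hvw (p.coeff n) (.inl (.inr rfl))
  have hcoeff : ∀ g ∈ G, ∀ i,
      SignType.sign (ev v (g.coeff i)) = SignType.sign (ev w (g.coeff i)) := by
    intro g hg i
    rcases le_or_gt i n with hi | hi
    · exact hvw _ (.inr ⟨g, hg, i, hi, rfl⟩)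
    · simp [coeff_eq_zero_of_natDegree_lt ((hGn g hg).trans_lt hi)]
  by_cases hv : ev v (p.coeff n) = 0
  · have hw : ev w (p.coeff n) = 0 := by
      rwa [hv, sign_zero, eq_comm, sign_eq_zero_iff] at hc
    obtain ⟨h, hh⟩ := hB' v w fun a ha => hvw a (.inl (.inl (.inr ha)))
    refine ⟨h, fun f hf => ?_⟩
    rcases hf with rfl | hf
    · have herase : ∀ u, ev u (f.coeff n) = 0 → (f.erase n).map (ev u) = f.map (ev u) := by
        intro u hu
        ext i
        rw [coeff_map, coeff_map, coeff_erase]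
        split_ifs with hi
        · rw [hi, hu, map_zero]
        · rfl
      have := hh _ (.inl rfl)
      rwa [herase v hv, herase w hw] at this
    · exact hh f (.inr hf)
  have hw : ev w (p.coeff n) ≠ 0 := by
    rwa [← sign_ne_zero, ← hc, sign_ne_zero]
  have hdeg : ∀ u, ev u (p.coeff n) ≠ 0 → (p.map (ev u)).natDegree = n := fun u hu =>
    natDegree_eq_of_le_of_coeff_ne_zero (natDegree_map_le.trans hpn) (by rwa [coeff_map])
  obtain ⟨h, hh⟩ := hA' v w fun a ha => hvw a (.inl (.inl (.inl ha)))
  suffices H : ∀ g ∈ G, g.map (ev v) ≠ 0 → ∀ x, (g.map (ev v)).eval x = 0 →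
      SignType.sign ((p.map (ev v)).eval x) = SignType.sign ((p.map (ev w)).eval (h x)) by
    obtain ⟨h', h1, h2⟩ := exists_signCompatible_extension
      (G := (fun g : R[X] => (g.map (ev v), g.map (ev w))) '' G) (hGf.image _) (h := h)
      (P := p.map (ev v)) (Q := p.map (ev w))
      (by rintro _ ⟨g, hg, rfl⟩; exact hh g (.inl hg))
      ⟨_, hder, by simp only [derivative_map]⟩ (by rw [hdeg v hv, hdeg w hw])
      (by rw [leadingCoeff, leadingCoeff, hdeg v hv, hdeg w hw, coeff_map, coeff_map, hc])
      (by rintro _ ⟨g, hg, rfl⟩; exact H g hg)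
    refine ⟨h', fun f hf => ?_⟩
    rcases hf with rfl | hf
    · exact h2
    · exact h1 _ ⟨f, hf, rfl⟩
  intro g hg hg0 x hx
  have hxw := ((hh g (.inl hg)).eval_eq_zero_iff x).1 hx
  have hj : (g.map (ev v)).natDegree ≤ n := natDegree_map_le.trans (hGn g hg)
  obtain ⟨N, q, r, hr, hqr⟩ := hrem g hg _ hj
  have htv : ∀ i, (g.map (ev v)).natDegree < i → ev v (g.coeff i) = 0 := fun i hi => by
    rw [← coeff_map]; exact coeff_eq_zero_of_natDegree_lt hi
  have htw : ∀ i, (g.map (ev v)).natDegree < i → ev w (g.coeff i) = 0 := fun i hi => by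
    rw [← sign_eq_zero_iff, ← hcoeff g hg, htv i hi, sign_zero]
  have hlv : ev v (g.coeff (g.map (ev v)).natDegree) ≠ 0 := by
    rw [← coeff_map]; exact leadingCoeff_ne_zero.2 hg0
  have hlw : ev w (g.coeff (g.map (ev v)).natDegree) ≠ 0 := by
    rwa [← sign_ne_zero, ← hcoeff g hg, sign_ne_zero]
  rw [sign_eval_eq_sign_remainder hqr hlv (by rwa [map_trunc_eq htv]),
    sign_eval_eq_sign_remainder hqr hlw (by rwa [map_trunc_eq htw])]
  exact hh r (.inr hr) x

theorem SignControlled.mono {ev : V → R →+* k} {F G : Set R[X]} (h : SignControlled ev G)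
    (hFG : F ⊆ G) : SignControlled ev F := by
  obtain ⟨A, hA, hA'⟩ := h
  exact ⟨A, hA, fun v w hvw => (hA' v w hvw).imp fun h hh f hf => hh f (hFG hf)⟩

/-- Induction on the degree bound, then on the number of polynomials subject to it. One polynomial
`p` is traded for its derivative, `p.erase n` and its pseudo-remainders, all of degree below `n`. -/
theorem signControlled_of_degree_lt [IsRealClosed k] (ev : V → R →+* k) (n : ℕ) {F : Set R[X]}
    (hF : F.Finite) (hn : ∀ f ∈ F, f.degree < n) : SignControlled ev F := by
  induction n generalizing F with
  | zero =>
    refine ⟨∅, Set.finite_empty, fun v w _ => ⟨OrderIso.refl k, fun f hf x => ?_⟩⟩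
    have : f = 0 := by simpa using hn f hf
    simp [this]
  | succ n ih =>
    -- An arbitrary finite set `L` of lower degree polynomials is carried along, since the inner
    -- induction adds to it.
    suffices H : ∀ L : Set R[X], L.Finite → (∀ f ∈ L, f.degree < n) → SignControlled ev (F ∪ L) by
      simpa using H ∅ Set.finite_empty (by simp)
    induction F, hF using Set.Finite.induction_on with
    | empty => intro L hL hLn; simpa using ih hL hLn
    | @insert p T _ hT ihT =>
      intro L hL hLn
      have ihT := ihT fun f hf => hn f (.inr hf)
      have hp : p.degree < (n + 1 : ℕ) := hn p (.inl rfl)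
      have hpn : p.natDegree ≤ n := natDegree_le_of_degree_lt_succ hp
      have hcoeff : ∀ i, n < i → p.coeff i = 0 := fun i hi =>
        coeff_eq_zero_of_natDegree_lt (hpn.trans_lt hi)
      have hp' : (derivative p).degree < n := by
        rw [degree_lt_iff_coeff_zero]
        intro i hi
        rw [coeff_derivative, hcoeff _ (by omega), zero_mul]
      have hpe : (p.erase n).degree < n := by
        rw [degree_lt_iff_coeff_zero]
        intro i hi
        rw [coeff_erase]
        split_ifs with h
        · rfl
        · exact hcoeff i (by omega)
      let G := T ∪ insert (derivative p) L
      have hL' : (insert (derivative p) L).Finite := hL.insert _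
      have hLn' : ∀ f ∈ insert (derivative p) L, f.degree < n := by
        rintro f (rfl | hf)
        · exact hp'
        · exact hLn f hf
      have hGn : ∀ g ∈ G, g.natDegree ≤ n := by
        rintro g (hg | hg)
        · exact natDegree_le_of_degree_lt_succ (hn g (.inr hg))
        · exact natDegree_le_of_degree_le (hLn' g hg).le
      have hdiv : ∀ (g : R[X]) (j : ℕ), ∃ (r : R[X]), (∃ (N : ℕ) (q : R[X]),
          C (g.coeff j ^ (2 * N)) * p = q * PowerSeries.trunc (j + 1) (g : PowerSeries R) + r) ∧
          r.degree < j := by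
        intro g j
        obtain ⟨N, q, r, h1, h2⟩ := exists_pseudo_division p (j := j)
          (g := PowerSeries.trunc (j + 1) (g : PowerSeries R))
          (Nat.le_of_lt_succ (PowerSeries.natDegree_trunc_lt _ _))
        rw [PowerSeries.coeff_trunc, if_pos (Nat.lt_succ_self j), coeff_coe] at h1
        exact ⟨r, ⟨N, q, h1⟩, h2⟩
      choose r hr hrdeg using hdiv
      let M := Set.image2 r G (Set.Iic n)
      have hM : M.Finite := (hT.union hL').image2 _ (Set.finite_Iic n)
      have hMn : ∀ f ∈ M, f.degree < n := by
        rintro _ ⟨g, _, j, hj, rfl⟩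
        exact (hrdeg g j).trans_le (by exact_mod_cast hj)
      have key : SignControlled ev (insert p G) := by
        refine SignControlled.of_remainders (n := n) (M := M) (hT.union hL') hGn hpn
          (.inr (.inl rfl)) (fun g hg j hj => ?_) ?_ ?_
        · obtain ⟨N, q, h⟩ := hr g j
          exact ⟨N, q, r g j, ⟨g, hg, j, hj, rfl⟩, h⟩
        · rw [Set.union_assoc]
          exact ihT _ (hL'.union hM) fun f hf => hf.elim (hLn' f) (hMn f)
        · rw [← Set.union_insert]
          refine ihT _ (hL'.insert _) fun f hf => ?_
          rcases hf with rfl | hf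
          · exact hpe
          · exact hLn' f hf
      refine key.mono ?_
      rw [Set.insert_union]
      exact Set.insert_subset_insert (Set.union_subset_union_right _ (Set.subset_insert _ _))

theorem signControlled_of_finite [IsRealClosed k] (ev : V → R →+* k) {F : Set R[X]}
    (hF : F.Finite) : SignControlled ev F := by
  obtain ⟨n, hn⟩ := (hF.image natDegree).bddAbove
  refine signControlled_of_degree_lt ev (n + 1) hF fun f hf => ?_
  exact degree_le_natDegree.trans_lt
    (by exact_mod_cast Nat.lt_succ_of_le (hn (Set.mem_image_of_mem _ hf)))

/-- The set `S` is a union of classes of points at which finitely many functions in `A` have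
given signs. -/
def SignDetermined (A : Set (V → k)) (S : Set V) : Prop :=
  ∃ F ⊆ A, F.Finite ∧
    ∀ v w, (∀ f ∈ F, SignType.sign (f v) = SignType.sign (f w)) → v ∈ S → w ∈ S

namespace SignDetermined

variable {A : Set (V → k)} {B : Set (W → k)} {S T : Set V}

theorem empty : SignDetermined A (∅ : Set V) :=
  ⟨∅, by simp, Set.finite_empty, fun _ _ _ h => h⟩

theorem compl (h : SignDetermined A S) : SignDetermined A Sᶜ := by
  obtain ⟨F, hF, hFf, h⟩ := h
  exact ⟨F, hF, hFf, fun v w hvw hv hw => hv (h w v (fun f hf => (hvw f hf).symm) hw)⟩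

theorem union (hS : SignDetermined A S) (hT : SignDetermined A T) :
    SignDetermined A (S ∪ T) := by
  obtain ⟨F, hF, hFf, h⟩ := hS
  obtain ⟨G, hG, hGf, h'⟩ := hT
  exact ⟨F ∪ G, Set.union_subset hF hG, hFf.union hGf, fun v w hvw => Or.imp
    (h v w fun f hf => hvw f (.inl hf)) (h' v w fun f hf => hvw f (.inr hf))⟩

theorem inter (hS : SignDetermined A S) (hT : SignDetermined A T) :
    SignDetermined A (S ∩ T) := by
  simpa [Set.compl_union] using (hS.compl.union hT.compl).compl

theorem iUnion {ι : Type*} [Finite ι] {S : ι → Set V} (h : ∀ i, SignDetermined A (S i)) :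
    SignDetermined A (⋃ i, S i) := by
  choose F hF hFf h using h
  refine ⟨⋃ i, F i, Set.iUnion_subset hF, Set.finite_iUnion hFf, fun v w hvw hv => ?_⟩
  obtain ⟨i, hi⟩ := Set.mem_iUnion.1 hv
  exact Set.mem_iUnion.2 ⟨i, h i v w (fun f hf => hvw f (Set.mem_iUnion.2 ⟨i, hf⟩)) hi⟩

theorem setOf_sign {f : V → k} (hf : f ∈ A) (p : SignType → Prop) :
    SignDetermined A {v | p (SignType.sign (f v))} :=
  ⟨{f}, by simpa using hf, Set.finite_singleton f, fun v w hvw hv => by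
    have := hvw f rfl
    simpa only [Set.mem_ofPred_eq, ← this] using hv⟩

theorem preimage (hS : SignDetermined A S) (g : W → V) (hg : ∀ f ∈ A, f ∘ g ∈ B) :
    SignDetermined B (g ⁻¹' S) := by
  obtain ⟨F, hF, hFf, h⟩ := hS
  refine ⟨(· ∘ g) '' F, ?_, hFf.image _, fun v w hvw => h _ _ fun f hf =>
    hvw _ (Set.mem_image_of_mem _ hf)⟩
  rintro _ ⟨f, hf, rfl⟩
  exact hg f (hF hf)

end SignDetermined

/-- The polynomials with coefficients in the ring `A` of functions on `V`, as functions on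
`V × k`. -/
noncomputable def polynomialFunctionHom (A : Subring (V → k)) : A[X] →+* (V × k → k) :=
  Polynomial.eval₂RingHom
    ((RingHom.pi fun x : V × k => Pi.evalRingHom (fun _ : V => k) x.1).comp A.subtype) Prod.snd

theorem polynomialFunctionHom_apply (A : Subring (V → k)) (p : A[X]) (v : V) (x : k) :
    polynomialFunctionHom A p (v, x) =
      (p.map ((Pi.evalRingHom (fun _ : V => k) v).comp A.subtype)).eval x := by
  rw [eval_map]
  have := Polynomial.hom_eval₂ p
    ((RingHom.pi fun x : V × k => Pi.evalRingHom (fun _ : V => k) x.1).comp A.subtype)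
    (Pi.evalRingHom (fun _ : V × k => k) (v, x)) Prod.snd
  exact this

/-- The ring of functions on `V × k` that are polynomial in the second variable, with coefficients
in the ring `A` of functions on `V`. -/
noncomputable def polynomialFunctionSubring (A : Subring (V → k)) : Subring (V × k → k) :=
  (polynomialFunctionHom A).range

theorem comp_fst_mem_polynomialFunctionSubring {A : Subring (V → k)} {f : V → k} (hf : f ∈ A) :
    (fun x : V × k => f x.1) ∈ polynomialFunctionSubring A :=
  ⟨C ⟨f, hf⟩, by ext ⟨v, x⟩; simp [polynomialFunctionHom_apply]⟩

theorem snd_mem_polynomialFunctionSubring (A : Subring (V → k)) :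
    (Prod.snd : V × k → k) ∈ polynomialFunctionSubring A :=
  ⟨X, by ext ⟨v, x⟩; simp [polynomialFunctionHom_apply]⟩

/-- The Tarski–Seidenberg theorem. -/
theorem SignDetermined.exists_snd [IsRealClosed k] {A : Subring (V → k)} {S : Set (V × k)}
    (hS : SignDetermined (polynomialFunctionSubring A : Set (V × k → k)) S) :
    SignDetermined (A : Set (V → k)) {v | ∃ x, (v, x) ∈ S} := by
  obtain ⟨F, hF, hFf, h⟩ := hS
  have hF' : ∀ f ∈ F, ∃ p, polynomialFunctionHom A p = f := fun f hf => hF hf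
  choose! g hg using hF'
  obtain ⟨B, hB, hB'⟩ := signControlled_of_finite
    (fun v : V => (Pi.evalRingHom (fun _ : V => k) v).comp A.subtype) (hFf.image g)
  refine ⟨Subtype.val '' B, ?_, hB.image _, ?_⟩
  · rintro _ ⟨b, -, rfl⟩
    exact b.2
  · rintro v w hvw ⟨x, hx⟩
    -- The order automorphism sends a witness over `v` to a witness over `w`.
    obtain ⟨e, he⟩ := hB' v w fun a ha => hvw _ (Set.mem_image_of_mem _ ha)
    refine ⟨e x, h _ _ ?_ hx⟩
    intro f hf
    rw [← hg f hf, polynomialFunctionHom_apply, polynomialFunctionHom_apply]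
    exact he _ (Set.mem_image_of_mem g hf) x

end Elimination

/-! ### Real and imaginary parts, and the sets defined by formulas -/

section ComplexCoordinates

set_option linter.unusedSectionVars false

/-- A description of the elements of the field extension `K` of `k` as `a + b i` with unique `a`
and `b` in `k`, where `i ^ 2 = -1`. -/
structure ComplexCoordinates (k K : Type*) [Field k] [Field K] [Algebra k K] where
  i : K
  re : K → k
  im : K → k
  i_sq : i ^ 2 = -1
  eq_add_mul : ∀ x, x = algebraMap k K (re x) + algebraMap k K (im x) * i
  unique : ∀ a b c d : k, algebraMap k K a + algebraMap k K b * i =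
    algebraMap k K c + algebraMap k K d * i → a = c ∧ b = d

theorem IsRealClosed.nonempty_complexCoordinates (k K : Type*) [Field k] [LinearOrder k]
    [IsStrictOrderedRing k] [IsRealClosed k] [Field K] [Algebra k K] [IsAlgClosure k K] :
    Nonempty (ComplexCoordinates k K) := by
  have : IsAlgClosed K := IsAlgClosure.isAlgClosed k
  obtain ⟨i, hi⟩ := IsAlgClosed.exists_pow_nat_eq (-1 : K) (n := 2) (by norm_num)
  choose re im h using fun x : K => exists_eq_add_mul (k := k) hi x
  refine ⟨⟨i, re, im, hi, h, fun a b c d habcd => ?_⟩⟩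
  have hinj := (algebraMap k K).injective
  -- Squaring `a - c = -(b - d) i` gives a vanishing sum of two squares in `k`.
  have hsq : (a - c) ^ 2 = -(b - d) ^ 2 := by
    apply hinj
    have : algebraMap k K (a - c) = -algebraMap k K (b - d) * i := by
      simp only [map_sub]
      linear_combination habcd
    rw [map_neg, map_pow, map_pow, this]
    linear_combination (algebraMap k K (b - d)) ^ 2 * hi
  constructor <;> nlinarith [sq_nonneg (a - c), sq_nonneg (b - d)]

namespace ComplexCoordinates

variable {k K : Type*} [Field k] [LinearOrder k] [IsStrictOrderedRing k] [Field K] [Algebra k K]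
variable (c : ComplexCoordinates k K)

/-- The element `a + b i`. -/
def mk' (a b : k) : K := algebraMap k K a + algebraMap k K b * c.i

theorem re_im_mk' (a b : k) : c.re (c.mk' a b) = a ∧ c.im (c.mk' a b) = b :=
  c.unique _ _ _ _ (c.eq_add_mul _).symm

@[simp] theorem re_mk' (a b : k) : c.re (c.mk' a b) = a := (c.re_im_mk' a b).1

@[simp] theorem im_mk' (a b : k) : c.im (c.mk' a b) = b := (c.re_im_mk' a b).2

@[simp] theorem mk'_re_im (x : K) : c.mk' (c.re x) (c.im x) = x := (c.eq_add_mul x).symm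

theorem ext_iff {x y : K} : x = y ↔ c.re x = c.re y ∧ c.im x = c.im y := by
  refine ⟨by rintro rfl; simp, fun h => ?_⟩
  rw [← c.mk'_re_im x, h.1, h.2, c.mk'_re_im]

theorem re_im_of_eq {x : K} {a b : k} (h : x = c.mk' a b) : c.re x = a ∧ c.im x = b := by
  rw [h]; exact c.re_im_mk' a b

theorem re_im_algebraMap (a : k) : c.re (algebraMap k K a) = a ∧ c.im (algebraMap k K a) = 0 :=
  c.re_im_of_eq (by simp [mk'])

@[simp] theorem re_algebraMap (a : k) : c.re (algebraMap k K a) = a := (c.re_im_algebraMap a).1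

@[simp] theorem im_algebraMap (a : k) : c.im (algebraMap k K a) = 0 := (c.re_im_algebraMap a).2

@[simp] theorem re_zero : c.re 0 = 0 := by rw [← map_zero (algebraMap k K), re_algebraMap]
@[simp] theorem im_zero : c.im 0 = 0 := by rw [← map_zero (algebraMap k K), im_algebraMap]
@[simp] theorem re_one : c.re 1 = 1 := by rw [← map_one (algebraMap k K), re_algebraMap]
@[simp] theorem im_one : c.im 1 = 0 := by rw [← map_one (algebraMap k K), im_algebraMap]

theorem re_im_add (x y : K) : c.re (x + y) = c.re x + c.re y ∧ c.im (x + y) = c.im x + c.im y := by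
  refine c.re_im_of_eq ?_
  rw [mk', map_add, map_add]
  linear_combination c.eq_add_mul x + c.eq_add_mul y

@[simp] theorem re_add (x y : K) : c.re (x + y) = c.re x + c.re y := (c.re_im_add x y).1
@[simp] theorem im_add (x y : K) : c.im (x + y) = c.im x + c.im y := (c.re_im_add x y).2

theorem re_im_mul (x y : K) : c.re (x * y) = c.re x * c.re y - c.im x * c.im y ∧
    c.im (x * y) = c.re x * c.im y + c.im x * c.re y := by
  refine c.re_im_of_eq ?_
  have hx := c.eq_add_mul x
  have hy := c.eq_add_mul y
  conv_lhs => rw [hx, hy]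
  simp only [mk', map_add, map_sub, map_mul]
  linear_combination algebraMap k K (c.im x) * algebraMap k K (c.im y) * c.i_sq

@[simp] theorem re_mul (x y : K) : c.re (x * y) = c.re x * c.re y - c.im x * c.im y :=
  (c.re_im_mul x y).1
@[simp] theorem im_mul (x y : K) : c.im (x * y) = c.re x * c.im y + c.im x * c.re y :=
  (c.re_im_mul x y).2

/-- Complex conjugation. -/
def conj (x : K) : K := c.mk' (c.re x) (-c.im x)

@[simp] theorem re_conj (x : K) : c.re (c.conj x) = c.re x := c.re_mk' _ _
@[simp] theorem im_conj (x : K) : c.im (c.conj x) = -c.im x := c.im_mk' _ _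

theorem conj_conj (x : K) : c.conj (c.conj x) = x := c.ext_iff.2 (by simp)

/-- The ring of polynomial functions in the real and imaginary parts of the coordinates. -/
def coordinateRing (α : Type*) : Subring ((α → K) → k) :=
  Subring.closure (Set.range (fun a v => c.re (v a)) ∪ Set.range (fun a v => c.im (v a)))

variable {α : Type*}

theorem re_mem_coordinateRing (a : α) : (fun v => c.re (v a)) ∈ c.coordinateRing α :=
  Subring.subset_closure (.inl ⟨a, rfl⟩)

theorem im_mem_coordinateRing (a : α) : (fun v => c.im (v a)) ∈ c.coordinateRing α :=
  Subring.subset_closure (.inr ⟨a, rfl⟩)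

theorem comp_mem_of_mem_coordinateRing {W : Type*} {B : Subring (W → k)} (g : W → α → K)
    (hre : ∀ a, (fun w => c.re (g w a)) ∈ B) (him : ∀ a, (fun w => c.im (g w a)) ∈ B)
    {f : (α → K) → k} (hf : f ∈ c.coordinateRing α) : f ∘ g ∈ B := by
  let φ : ((α → K) → k) →+* (W → k) := RingHom.pi fun w => Pi.evalRingHom (fun _ => k) (g w)
  have : c.coordinateRing α ≤ B.comap φ := by
    refine Subring.closure_le.2 (Set.union_subset ?_ ?_)
    · rintro _ ⟨a, rfl⟩; exact hre a
    · rintro _ ⟨a, rfl⟩; exact him a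
  exact this hf

/-- The structure on `K` is that of `(+, ·, 0, 1, *, ≤)`. -/
structure Interprets [starOrderedRing.Structure K] : Prop where
  add : ∀ x : Fin 2 → K,
    Language.Structure.funMap (L := starOrderedRing) StarOrderedRingFunc.add x = x 0 + x 1
  mul : ∀ x : Fin 2 → K,
    Language.Structure.funMap (L := starOrderedRing) StarOrderedRingFunc.mul x = x 0 * x 1
  zero : ∀ x : Fin 0 → K,
    Language.Structure.funMap (L := starOrderedRing) StarOrderedRingFunc.zero x = 0
  one : ∀ x : Fin 0 → K,
    Language.Structure.funMap (L := starOrderedRing) StarOrderedRingFunc.one x = 1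
  star : ∀ x : Fin 1 → K,
    Language.Structure.funMap (L := starOrderedRing) StarOrderedRingFunc.star x = c.conj (x 0)
  le : ∀ x : Fin 2 → K,
    Language.Structure.RelMap (L := starOrderedRing) StarOrderedRingRel.le x ↔
      c.im (x 0) = 0 ∧ c.im (x 1) = 0 ∧ c.re (x 0) ≤ c.re (x 1)

variable [starOrderedRing.Structure K] {c}

theorem Interprets.re_im_realize_mem (H : c.Interprets) (t : starOrderedRing.Term α) :
    (fun v : α → K => c.re (t.realize v)) ∈ c.coordinateRing α ∧
      (fun v : α → K => c.im (t.realize v)) ∈ c.coordinateRing α := by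
  have of_eq : ∀ {t : starOrderedRing.Term α} (g : (α → K) → K), (∀ v, t.realize v = g v) →
      ((fun v => c.re (g v)) ∈ c.coordinateRing α ∧ (fun v => c.im (g v)) ∈ c.coordinateRing α) →
      (fun v => c.re (t.realize v)) ∈ c.coordinateRing α ∧
        (fun v => c.im (t.realize v)) ∈ c.coordinateRing α := by
    intro t g h
    simp only [h, imp_self]
  induction t with
  | var a => exact ⟨c.re_mem_coordinateRing a, c.im_mem_coordinateRing a⟩
  | func f ts ih =>
    cases f with
    | add =>
      refine of_eq _ (fun v => H.add _) ?_
      simp only [re_add, im_add]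
      exact ⟨add_mem (ih 0).1 (ih 1).1, add_mem (ih 0).2 (ih 1).2⟩
    | mul =>
      refine of_eq _ (fun v => H.mul _) ?_
      simp only [re_mul, im_mul]
      exact ⟨sub_mem (mul_mem (ih 0).1 (ih 1).1) (mul_mem (ih 0).2 (ih 1).2),
        add_mem (mul_mem (ih 0).1 (ih 1).2) (mul_mem (ih 0).2 (ih 1).1)⟩
    | zero =>
      refine of_eq _ (fun v => H.zero _) ?_
      simp only [re_zero, im_zero]
      exact ⟨zero_mem _, zero_mem _⟩
    | one =>
      refine of_eq _ (fun v => H.one _) ?_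
      simp only [re_one, im_one]
      exact ⟨one_mem _, zero_mem _⟩
    | star =>
      refine of_eq _ (fun v => H.star _) ?_
      simp only [re_conj, im_conj]
      exact ⟨(ih 0).1, neg_mem (ih 0).2⟩

theorem Interprets.signDetermined_boundedFormula [IsRealClosed k] (H : c.Interprets) {n : ℕ}
    (φ : starOrderedRing.BoundedFormula α n) :
    SignDetermined (c.coordinateRing (α ⊕ Fin n) : Set ((α ⊕ Fin n → K) → k))
      {p | φ.Realize (p ∘ Sum.inl) (p ∘ Sum.inr)} := by
  induction φ with
  | falsum => exact SignDetermined.empty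
  | equal t₁ t₂ =>
    obtain ⟨h1, h1'⟩ := H.re_im_realize_mem t₁
    obtain ⟨h2, h2'⟩ := H.re_im_realize_mem t₂
    convert (SignDetermined.setOf_sign (sub_mem h1 h2) (· = 0)).inter
      (SignDetermined.setOf_sign (sub_mem h1' h2') (· = 0)) using 1
    ext p
    simp [Language.BoundedFormula.Realize, Sum.elim_comp_inl_inr, c.ext_iff, sub_eq_zero]
  | rel R ts =>
    cases R with
    | le =>
      obtain ⟨h1, h1'⟩ := H.re_im_realize_mem (ts 0)
      obtain ⟨h2, h2'⟩ := H.re_im_realize_mem (ts 1)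
      convert (SignDetermined.setOf_sign h1' (· = 0)).inter
        ((SignDetermined.setOf_sign h2' (· = 0)).inter
          (SignDetermined.setOf_sign (sub_mem h2 h1) (0 ≤ ·))) using 1
      ext p
      simp [Language.BoundedFormula.Realize, Sum.elim_comp_inl_inr, H.le]
  | imp φ ψ h1 h2 =>
    convert h1.compl.union h2 using 1
    ext p
    simp [imp_iff_not_or]
  | @all n φ ih =>
    -- The quantified variable is split into its real part `q.1.2` and imaginary part `q.2`, which
    -- are eliminated one after the other.
    let g : ((α ⊕ Fin n → K) × k) × k → (α ⊕ Fin (n + 1) → K) := fun q =>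
      Sum.elim (q.1.1 ∘ Sum.inl) (Fin.snoc (q.1.1 ∘ Sum.inr) (c.mk' q.1.2 q.2))
    have hmem : ∀ f ∈ c.coordinateRing (α ⊕ Fin (n + 1)), f ∘ g ∈
        polynomialFunctionSubring (polynomialFunctionSubring (c.coordinateRing (α ⊕ Fin n))) := by
      intro f hf
      have h0 : ∀ b, (fun q : ((α ⊕ Fin n → K) × k) × k => c.re (q.1.1 b)) ∈
          polynomialFunctionSubring
            (polynomialFunctionSubring (c.coordinateRing (α ⊕ Fin n))) := fun b =>
        comp_fst_mem_polynomialFunctionSubring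
          (comp_fst_mem_polynomialFunctionSubring (c.re_mem_coordinateRing b))
      have h1 : ∀ b, (fun q : ((α ⊕ Fin n → K) × k) × k => c.im (q.1.1 b)) ∈
          polynomialFunctionSubring
            (polynomialFunctionSubring (c.coordinateRing (α ⊕ Fin n))) := fun b =>
        comp_fst_mem_polynomialFunctionSubring
          (comp_fst_mem_polynomialFunctionSubring (c.im_mem_coordinateRing b))
      refine c.comp_mem_of_mem_coordinateRing g ?_ ?_ hf
      · rintro (b | b)
        · exact h0 (.inl b)
        · induction b using Fin.lastCases with
          | last =>
            simp only [g, Sum.elim_inr, Fin.snoc_last, re_mk']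
            exact comp_fst_mem_polynomialFunctionSubring (snd_mem_polynomialFunctionSubring _)
          | cast b =>
            simp only [g, Sum.elim_inr, Fin.snoc_castSucc]
            exact h0 (.inr b)
      · rintro (b | b)
        · exact h1 (.inl b)
        · induction b using Fin.lastCases with
          | last =>
            simp only [g, Sum.elim_inr, Fin.snoc_last, im_mk']
            exact snd_mem_polynomialFunctionSubring _
          | cast b =>
            simp only [g, Sum.elim_inr, Fin.snoc_castSucc]
            exact h1 (.inr b)
    convert (ih.compl.preimage g hmem).exists_snd.exists_snd.compl using 1
    ext p
    simp only [Language.BoundedFormula.realize_all, Set.mem_compl_iff, Set.mem_ofPred_eq,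
      Set.mem_preimage, g, Sum.elim_comp_inl, Sum.elim_comp_inr, not_exists, not_not]
    exact ⟨fun h a b => h _, fun h x => by simpa using h (c.re x) (c.im x)⟩

theorem Interprets.signDetermined_formula [IsRealClosed k] (H : c.Interprets)
    (φ : starOrderedRing.Formula α) :
    SignDetermined (c.coordinateRing α : Set ((α → K) → k)) {v | φ.Realize v} := by
  have := (H.signDetermined_boundedFormula φ).preimage (B := (c.coordinateRing α : Set _))
    (fun v : α → K => Sum.elim v default) fun f hf =>
      c.comp_mem_of_mem_coordinateRing _ (fun b => ?_) (fun b => ?_) hf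
  · exact this
  · rcases b with b | b
    · exact c.re_mem_coordinateRing b
    · exact b.elim0
  · rcases b with b | b
    · exact c.im_mem_coordinateRing b
    · exact b.elim0

/-- Conjugation is an automorphism of the structure, and formulas have no parameters. This
invariance makes up for the imaginary parts not being expressible. -/
theorem Interprets.realize_conj_comp (H : c.Interprets) (φ : starOrderedRing.Formula α)
    (v : α → K) : φ.Realize (c.conj ∘ v) ↔ φ.Realize v := by
  let e : K ≃[starOrderedRing] K :=
    { toFun := c.conj
      invFun := c.conj
      left_inv := c.conj_conj
      right_inv := c.conj_conj
      map_fun' := fun f x => by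
        cases f with
        | add => simp [H.add, c.ext_iff, add_comm]
        | mul => simp [H.mul, c.ext_iff, add_comm]
        | zero => simp [H.zero, c.ext_iff]
        | one => simp [H.one, c.ext_iff]
        | star => simp [H.star]
      map_rel' := fun R x => by
        cases R with
        | le => simp [H.le] }
  exact Language.StrongHomClass.realize_formula e φ

end ComplexCoordinates

end ComplexCoordinates

/-! ### From sign conditions back to quantifier-free formulas -/

section QuantifierFree

set_option linter.unusedSectionVars false

/-- The set `S` is defined by a quantifier-free formula. -/
def QFDefinable (L : Language) {M α : Type*} [L.Structure M] (S : Set (α → M)) : Prop :=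
  ∃ ψ : L.Formula α, ψ.IsQF ∧ S = {v | ψ.Realize v}

namespace QFDefinable

variable {L : Language} {M α : Type*} [L.Structure M] {S T : Set (α → M)}

theorem empty : QFDefinable L (∅ : Set (α → M)) :=
  ⟨⊥, .falsum, by ext v; simp⟩

theorem compl (hS : QFDefinable L S) : QFDefinable L Sᶜ := by
  obtain ⟨ψ, hψ, rfl⟩ := hS
  exact ⟨ψ.not, hψ.not, by ext v; simp⟩

theorem union (hS : QFDefinable L S) (hT : QFDefinable L T) : QFDefinable L (S ∪ T) := by
  obtain ⟨ψ, hψ, rfl⟩ := hS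
  obtain ⟨χ, hχ, rfl⟩ := hT
  exact ⟨ψ ⊔ χ, hψ.sup hχ, by ext v; simp [Language.Formula.Realize]⟩

theorem inter (hS : QFDefinable L S) (hT : QFDefinable L T) : QFDefinable L (S ∩ T) := by
  simpa [Set.compl_union] using (hS.compl.union hT.compl).compl

theorem biUnion {ι : Type*} {I : Set ι} (hI : I.Finite) {S : ι → Set (α → M)}
    (h : ∀ i, QFDefinable L (S i)) : QFDefinable L (⋃ i ∈ I, S i) := by
  induction I, hI using Set.Finite.induction_on with
  | empty => simpa using empty
  | insert _ _ ih => rw [Set.biUnion_insert]; exact (h _).union ih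

theorem iUnion {ι : Type*} [Finite ι] {S : ι → Set (α → M)} (h : ∀ i, QFDefinable L (S i)) :
    QFDefinable L (⋃ i, S i) := by
  simpa using biUnion (Set.finite_univ (α := ι)) h

theorem iInter {ι : Type*} [Finite ι] {S : ι → Set (α → M)} (h : ∀ i, QFDefinable L (S i)) :
    QFDefinable L (⋂ i, S i) := by
  simpa [Set.compl_iUnion] using (iUnion fun i => (h i).compl).compl

end QFDefinable

/-- Sign-determined sets are finite unions of finite intersections of sign conditions. -/
theorem SignDetermined.qfDefinable {k M α : Type*} [Field k] [LinearOrder k]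
    {L : Language} [L.Structure M] {A : Set ((α → M) → k)} {S : Set (α → M)}
    (hS : SignDetermined A S)
    (hA : ∀ f ∈ A, ∀ s, QFDefinable L {v | SignType.sign (f v) = s}) : QFDefinable L S := by
  obtain ⟨F, hF, hFf, h⟩ := hS
  have : Finite F := hFf
  -- The sign vectors attained on `S`; there are only finitely many, and `S` is the union of their
  -- classes.
  let I : Set (F → SignType) := (fun v (f : F) => SignType.sign (f.1 v)) '' S
  have hSI : S = ⋃ ε ∈ I, ⋂ f : F, {v | SignType.sign (f.1 v) = ε f} := by
    ext v
    simp only [Set.mem_iUnion, Set.mem_iInter, I, Set.mem_image, exists_prop]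
    constructor
    · exact fun hv => ⟨_, ⟨v, hv, rfl⟩, fun f => rfl⟩
    · rintro ⟨_, ⟨w, hw, rfl⟩, hv⟩
      exact h w v (fun f hf => (hv ⟨f, hf⟩).symm) hw
  rw [hSI]
  exact .biUnion (Set.toFinite I) fun ε => .iInter fun f => hA f (hF f.2) _

namespace ComplexCoordinates

variable {k K : Type*} [Field k] [LinearOrder k] [IsStrictOrderedRing k] [Field K] [Algebra k K]
variable {c : ComplexCoordinates k K} {α : Type*} [starOrderedRing.Structure K]

/-- The term `0`. -/
def zeroTerm : starOrderedRing.Term α :=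
  Language.Term.func (L := starOrderedRing) StarOrderedRingFunc.zero Fin.elim0

/-- The term `1`. -/
def oneTerm : starOrderedRing.Term α :=
  Language.Term.func (L := starOrderedRing) StarOrderedRingFunc.one Fin.elim0

/-- The sum of two terms. -/
def addTerm (t s : starOrderedRing.Term α) : starOrderedRing.Term α :=
  Language.Functions.apply₂ (L := starOrderedRing) StarOrderedRingFunc.add t s

/-- The product of two terms. -/
def mulTerm (t s : starOrderedRing.Term α) : starOrderedRing.Term α :=
  Language.Functions.apply₂ (L := starOrderedRing) StarOrderedRingFunc.mul t s

/-- The conjugate of a term. -/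
def starTerm (t : starOrderedRing.Term α) : starOrderedRing.Term α :=
  Language.Functions.apply₁ (L := starOrderedRing) StarOrderedRingFunc.star t

theorem Interprets.realize_zeroTerm (H : c.Interprets) (v : α → K) : zeroTerm.realize v = 0 :=
  H.zero _

theorem Interprets.realize_oneTerm (H : c.Interprets) (v : α → K) : oneTerm.realize v = 1 :=
  H.one _

theorem Interprets.realize_addTerm (H : c.Interprets) (t s : starOrderedRing.Term α)
    (v : α → K) : (addTerm t s).realize v = t.realize v + s.realize v :=
  Language.Term.realize_functions_apply₂.trans (H.add _)

theorem Interprets.realize_mulTerm (H : c.Interprets) (t s : starOrderedRing.Term α)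
    (v : α → K) : (mulTerm t s).realize v = t.realize v * s.realize v :=
  Language.Term.realize_functions_apply₂.trans (H.mul _)

theorem Interprets.realize_starTerm (H : c.Interprets) (t : starOrderedRing.Term α)
    (v : α → K) : (starTerm t).realize v = c.conj (t.realize v) :=
  Language.Term.realize_functions_apply₁.trans (H.star _)

/-- The ring of differences of terms. -/
def Interprets.termRing (H : c.Interprets) (α : Type*) : Subring ((α → K) → K) where
  carrier := {f | ∃ t s : starOrderedRing.Term α, ∀ v, f v = t.realize v - s.realize v}
  zero_mem' := ⟨zeroTerm, zeroTerm, fun v => by simp⟩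
  one_mem' := ⟨oneTerm, zeroTerm, fun v => by simp [H.realize_zeroTerm, H.realize_oneTerm]⟩
  add_mem' := by
    rintro f g ⟨t, s, h⟩ ⟨t', s', h'⟩
    refine ⟨addTerm t t', addTerm s s', fun v => ?_⟩
    rw [H.realize_addTerm, H.realize_addTerm, Pi.add_apply, h, h']
    ring
  neg_mem' := by
    rintro f ⟨t, s, h⟩
    exact ⟨s, t, fun v => by rw [Pi.neg_apply, h, neg_sub]⟩
  mul_mem' := by
    rintro f g ⟨t, s, h⟩ ⟨t', s', h'⟩
    refine ⟨addTerm (mulTerm t t') (mulTerm s s'), addTerm (mulTerm t s') (mulTerm s t'),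
      fun v => ?_⟩
    simp only [H.realize_addTerm, H.realize_mulTerm, Pi.mul_apply, h, h']
    ring

theorem Interprets.realize_mem_termRing (H : c.Interprets) (t : starOrderedRing.Term α) :
    (fun v : α → K => t.realize v) ∈ H.termRing α :=
  ⟨t, zeroTerm, fun v => by simp [H.realize_zeroTerm]⟩

theorem Interprets.coord_mem_termRing (H : c.Interprets) (a : α) :
    (fun v : α → K => v a) ∈ H.termRing α :=
  H.realize_mem_termRing (.var a)

theorem Interprets.conj_coord_mem_termRing (H : c.Interprets) (a : α) :
    (fun v : α → K => c.conj (v a)) ∈ H.termRing α := by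
  simpa only [H.realize_starTerm, Language.Term.realize_var] using H.realize_mem_termRing (starTerm (.var a))

/-- The functions to `k` that are differences of terms up to a power of `2`. -/
def Interprets.definableRing (H : c.Interprets) (α : Type*) : Subring ((α → K) → k) where
  carrier := {f | ∃ N : ℕ, (fun v => 2 ^ N * algebraMap k K (f v)) ∈ H.termRing α}
  zero_mem' := ⟨0, by convert zero_mem (H.termRing α) using 1; ext; simp⟩
  one_mem' := ⟨0, by convert one_mem (H.termRing α) using 1; ext; simp⟩
  add_mem' := by
    rintro f g ⟨N, h⟩ ⟨M, h'⟩
    refine ⟨N + M, ?_⟩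
    have h2 : ∀ n : ℕ, (2 : (α → K) → K) ^ n ∈ H.termRing α := fun n => pow_mem (ofNat_mem _ 2) n
    convert add_mem (mul_mem (h2 M) h) (mul_mem (h2 N) h') using 1
    ext v
    simp only [Pi.add_apply, Pi.mul_apply, Pi.pow_apply, Pi.ofNat_apply, map_add]
    ring
  neg_mem' := by
    rintro f ⟨N, h⟩
    refine ⟨N, ?_⟩
    convert neg_mem h using 1
    ext v
    simp
  mul_mem' := by
    rintro f g ⟨N, h⟩ ⟨M, h'⟩
    refine ⟨N + M, ?_⟩
    convert mul_mem h h' using 1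
    ext v
    simp only [Pi.mul_apply, map_mul]
    ring

theorem Interprets.re_mem_definableRing (H : c.Interprets) (a : α) :
    (fun v : α → K => c.re (v a)) ∈ H.definableRing α := by
  refine ⟨1, ?_⟩
  convert add_mem (H.coord_mem_termRing a) (H.conj_coord_mem_termRing a) using 1
  ext v
  have h := c.eq_add_mul (v a)
  simp only [Pi.add_apply, conj, mk', map_neg]
  linear_combination -h

theorem Interprets.im_mul_im_mem_definableRing (H : c.Interprets) (a b : α) :
    (fun v : α → K => c.im (v a) * c.im (v b)) ∈ H.definableRing α := by
  -- The factor `2 ^ 2` comes from `(x - x*)(y - y*) = -4 * im x * im y`.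
  refine ⟨2, ?_⟩
  convert neg_mem (mul_mem (sub_mem (H.coord_mem_termRing a) (H.conj_coord_mem_termRing a))
    (sub_mem (H.coord_mem_termRing b) (H.conj_coord_mem_termRing b))) using 1
  ext v
  have key : ∀ x, x - c.conj x = 2 * algebraMap k K (c.im x) * c.i := fun x => by
    have h := c.eq_add_mul x
    simp only [conj, mk', map_neg]
    linear_combination h
  simp only [Pi.neg_apply, Pi.mul_apply, Pi.sub_apply, key, map_mul]
  linear_combination 4 * algebraMap k K (c.im (v a)) * algebraMap k K (c.im (v b)) * c.i_sq

theorem Interprets.qfDefinable_nonneg (H : c.Interprets) {f : (α → K) → k}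
    (hf : f ∈ H.definableRing α) : QFDefinable starOrderedRing {v : α → K | 0 ≤ f v} := by
  obtain ⟨N, t, s, h⟩ := hf
  -- Only the difference of `t` and `s` has values in `k`, while `≤` is false outside `k`. Adding
  -- the conjugate to each makes both sides real and doubles the difference.
  let T : starOrderedRing.Term α → starOrderedRing.Term (α ⊕ Fin 0) := fun t =>
    (addTerm t (starTerm t)).relabel Sum.inl
  have hT : ∀ (t : starOrderedRing.Term α) (v : α → K), c.re ((T t).realize (Sum.elim v default)) =
      2 * c.re (t.realize v) ∧ c.im ((T t).realize (Sum.elim v default)) = 0 := by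
    intro t v
    simp [T, H.realize_addTerm, H.realize_starTerm, two_mul]
  refine ⟨Language.Relations.boundedFormula (L := starOrderedRing) StarOrderedRingRel.le
    ![T s, T t], .of_isAtomic (.rel _ _), ?_⟩
  ext v
  refine Iff.trans ?_ (Language.BoundedFormula.realize_rel.trans (H.le _)).symm
  simp only [Set.mem_ofPred_eq, Matrix.cons_val_zero, Matrix.cons_val_one, hT, true_and]
  have h2 : c.re (t.realize v) = 2 ^ N * f v + c.re (s.realize v) := by
    have h3 : t.realize v = algebraMap k K (2 ^ N * f v) + s.realize v := by
      rw [map_mul, map_pow, map_ofNat]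
      linear_combination -h v
    rw [h3, re_add, re_algebraMap]
  rw [h2]
  have h4 : (0 : k) < 2 ^ N := by positivity
  constructor
  · intro h5
    have := mul_nonneg h4.le h5
    linarith
  · intro h5
    exact nonneg_of_mul_nonneg_right (by linarith) h4

theorem Interprets.qfDefinable_sign (H : c.Interprets) {f : (α → K) → k}
    (hf : f ∈ H.definableRing α) (s : SignType) :
    QFDefinable starOrderedRing {v : α → K | SignType.sign (f v) = s} := by
  have h1 := H.qfDefinable_nonneg hf
  have h2 := H.qfDefinable_nonneg (neg_mem hf)
  cases s with
  | zero =>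
    convert h1.inter h2 using 1
    ext v
    simpa using ⟨fun h => by simp [h], fun h => le_antisymm h.2 h.1⟩
  | neg =>
    convert h1.compl using 1
    ext v
    simpa using sign_eq_neg_one_iff
  | pos =>
    convert h2.compl using 1
    ext v
    simpa using sign_eq_one_iff

/-- Either `v` is real, and its real parts suffice, or some `im (v b)` is nonzero, and `v` is known
up to conjugation from the expressible products `im (v a) * im (v b)` after division by `|im (v
b)|`. The inverse of this absolute value is introduced as an existentially quantified `t > 0`, which
Tarski–Seidenberg over the expressible functions eliminates. -/
theorem Interprets.signDetermined_of_conj_invariant [IsRealClosed k] [Finite α]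
    (H : c.Interprets) {S : Set (α → K)}
    (hS : SignDetermined (c.coordinateRing α : Set ((α → K) → k)) S)
    (hconj : ∀ v, c.conj ∘ v ∈ S ↔ v ∈ S) :
    SignDetermined (H.definableRing α : Set ((α → K) → k)) S := by
  let g₀ : (α → K) → α → K := fun v a => c.mk' (c.re (v a)) 0
  let g : α → (α → K) × k → α → K := fun b p a =>
    c.mk' (c.re (p.1 a)) (p.2 * (c.im (p.1 a) * c.im (p.1 b)))
  have h₀ : SignDetermined (H.definableRing α : Set ((α → K) → k)) (g₀ ⁻¹' S) := by
    refine hS.preimage g₀ fun f hf => c.comp_mem_of_mem_coordinateRing g₀ (fun a => ?_)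
      (fun a => ?_) hf
    · simpa [g₀] using H.re_mem_definableRing a
    · simp only [g₀, im_mk']
      exact zero_mem (H.definableRing α)
  have hb : ∀ b, SignDetermined
      (polynomialFunctionSubring (H.definableRing α) : Set ((α → K) × k → k)) (g b ⁻¹' S) := by
    intro b
    refine hS.preimage (g b) fun f hf => c.comp_mem_of_mem_coordinateRing (g b) (fun a => ?_)
      (fun a => ?_) hf
    · simpa [g] using comp_fst_mem_polynomialFunctionSubring (H.re_mem_definableRing a)
    · simp only [g, im_mk']
      exact mul_mem (snd_mem_polynomialFunctionSubring _)
        (comp_fst_mem_polynomialFunctionSubring (H.im_mul_im_mem_definableRing a b))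
  have hreal : SignDetermined (H.definableRing α : Set ((α → K) → k))
      (⋃ a, {v : α → K | SignType.sign (c.im (v a) * c.im (v a)) ≠ 0})ᶜ :=
    (SignDetermined.iUnion fun a =>
      .setOf_sign (H.im_mul_im_mem_definableRing a a) (· ≠ 0)).compl
  have hpos : SignDetermined
      (polynomialFunctionSubring (H.definableRing α) : Set ((α → K) × k → k))
      {p | SignType.sign p.2 = 1} :=
    .setOf_sign (snd_mem_polynomialFunctionSubring _) (· = 1)
  have hinv : ∀ b, SignDetermined
      (polynomialFunctionSubring (H.definableRing α) : Set ((α → K) × k → k))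
      {p | SignType.sign (p.2 ^ 2 * (c.im (p.1 b) * c.im (p.1 b)) - 1) = 0} := fun b =>
    .setOf_sign (sub_mem (mul_mem (pow_mem (snd_mem_polynomialFunctionSubring _) 2)
      (comp_fst_mem_polynomialFunctionSubring (H.im_mul_im_mem_definableRing b b)))
      (one_mem _)) (· = 0)
  convert (h₀.inter hreal).union
    (SignDetermined.iUnion fun b => ((hpos.inter (hinv b)).inter (hb b)).exists_snd) using 1
  -- Here `t * im (v b) = ±1`, so `g b (v, t)` is `v` or its conjugate.
  have hg : ∀ b v t, 0 < t → t ^ 2 * (c.im (v b) * c.im (v b)) = 1 →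
      (g b (v, t) ∈ S ↔ v ∈ S) := by
    intro b v t ht h1
    have h2 : (t * c.im (v b)) ^ 2 = 1 := by linear_combination h1
    rcases sq_eq_sq_iff_eq_or_eq_neg.1 (h2.trans (one_pow 2).symm) with h3 | h3
    · have : g b (v, t) = v := by
        ext a
        rw [c.ext_iff]
        refine ⟨c.re_mk' _ _, (c.im_mk' _ _).trans ?_⟩
        linear_combination c.im (v a) * h3
      rw [this]
    · have : g b (v, t) = c.conj ∘ v := by
        ext a
        rw [c.ext_iff, Function.comp_apply, re_conj, im_conj]
        refine ⟨c.re_mk' _ _, (c.im_mk' _ _).trans ?_⟩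
        linear_combination c.im (v a) * h3
      rw [this, hconj]
  ext v
  simp only [Set.mem_union, Set.mem_inter_iff, Set.mem_compl_iff, Set.mem_iUnion,
    Set.mem_ofPred_eq, Set.mem_preimage, not_exists, not_not, sign_eq_zero_iff, sign_eq_one_iff,
    mul_self_eq_zero, sub_eq_zero, ne_eq]
  constructor
  · intro hv
    by_cases hr : ∀ a, c.im (v a) = 0
    · refine .inl ⟨?_, hr⟩
      have : g₀ v = v := by
        ext a
        rw [c.ext_iff]
        exact ⟨c.re_mk' _ _, (c.im_mk' _ _).trans (hr a).symm⟩
      rwa [this]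
    · push Not at hr
      obtain ⟨b, hb⟩ := hr
      have h1 : (|c.im (v b)|⁻¹) ^ 2 * (c.im (v b) * c.im (v b)) = 1 := by
        rw [← sq, inv_pow, sq_abs, inv_mul_cancel₀ (pow_ne_zero 2 hb)]
      have h2 : 0 < |c.im (v b)|⁻¹ := inv_pos.2 (abs_pos.2 hb)
      exact .inr ⟨b, _, ⟨h2, h1⟩, (hg b v _ h2 h1).2 hv⟩
  · rintro (⟨h, hr⟩ | ⟨b, t, ⟨ht, h1⟩, h⟩)
    · have : g₀ v = v := by
        ext a
        rw [c.ext_iff]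
        exact ⟨c.re_mk' _ _, (c.im_mk' _ _).trans (hr a).symm⟩
      rwa [this] at h
    · exact (hg b v t ht h1).1 h

theorem Interprets.admitsQuantifierElimination [IsRealClosed k] (H : c.Interprets) :
    AdmitsQuantifierElimination starOrderedRing K := fun _ φ =>
  (H.signDetermined_of_conj_invariant (H.signDetermined_formula φ)
    (H.realize_conj_comp φ)).qfDefinable fun _ hf => H.qfDefinable_sign hf

end ComplexCoordinates

end QuantifierFree

/-! ### The structure on the algebraic closure -/

theorem ComplexCoordinates.interprets_algClosureStructure {k K : Type*} [Field k] [LinearOrder k]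
    [IsStrictOrderedRing k] [IsRealClosed k] [Field K] [Algebra k K] [IsAlgClosure k K]
    (c : ComplexCoordinates k K) :
    letI : starOrderedRing.Structure K := algClosureStructure k K
    c.Interprets := by
  let _ : starOrderedRing.Structure K := algClosureStructure k K
  refine ⟨fun _ => rfl, fun _ => rfl, fun _ => rfl, fun _ => rfl, fun x => ?_, fun x => ?_⟩
  · change complexConj k K (x 0) = _
    conv_lhs => rw [c.eq_add_mul (x 0), complexConj_add_mul k K _ _ c.i_sq]
    simp [conj, mk', sub_eq_add_neg]
  · change (∃ a b : k, algebraMap k K a = x 0 ∧ algebraMap k K b = x 1 ∧ a ≤ b) ↔ _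
    constructor
    · rintro ⟨a, b, ha, hb, hab⟩
      simpa [← ha, ← hb] using hab
    · rintro ⟨h0, h1, h⟩
      exact ⟨_, _, c.ext_iff.2 (by simp [h0]), c.ext_iff.2 (by simp [h1]), h⟩

theorem mainTheorem3 (k : Type*) [Field k] [LinearOrder k] [IsStrictOrderedRing k]
    [IsRealClosed k] (K : Type*) [Field K] [Algebra k K] [IsAlgClosure k K] :
    letI : starOrderedRing.Structure K := algClosureStructure k K
    AdmitsQuantifierElimination starOrderedRing K := by
  let _ : starOrderedRing.Structure K := algClosureStructure k K
  obtain ⟨c⟩ := IsRealClosed.nonempty_complexCoordinates k K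
  exact c.interprets_algClosureStructure.admitsQuantifierElimination
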